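/- **The model.** Let $N\ge 1$, $T_L,T_R>0$, $K>0$, and let $R(x,y)=\min\{K,\sqrt{\min(x,y)}\}$. On $(0,\infty)^N$ let $\mathbf E_t=(E_1(t),\dots,E_N(t))$ be the Markov jump process in which, for $1\le i\le N-1$, at rate $R(E_i,E_{i+1})$ the pair $(E_i,E_{i+1})$ is replaced by $(p(E_i+E_{i+1}),(1-p)(E_i+E_{i+1}))$; at rate $R(T_L,E_1)$, $E_1$ is replaced by $p(E_1+X_L)$; and at rate $R(E_N,T_R)$, $E_N$ is replaced by $p(E_N+X_R)$. Here, at each event, $p$ is uniform on $(0,1)$ and $X_L,X_R$ are exponential with means $T_L,T_R$, all independent. Let $P^t$ be its transition kernels. Put $W(\mathbf E)=\sum_{i=1}^N E_i$ and, for $\eta>0$, $$V(\mathbf E)=V_\eta(\mathbf E)=\sum_{m=1}^{N}\sum_{i=1}^{N-m+1}\Big(\sum_{j=0}^{m-1}E_{i+j}\Big)^{a_m\eta-1},\qquad a_m=1-\frac{2^{m-1}-1}{2^N-1}.$$ For $\eta,h>0$ call $M_0>1$ an *admissible level* if there is $c_0>0$ with $P^hV(\mathbf E)-V(\mathbf E)\le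 -c_0V(\mathbf E)^{\alpha}$ for every $\mathbf E$ with $V(\mathbf E)>M_0$, where $\alpha=1-\frac1{2(1-\eta)}$. Given $M_0$, let $G=\{\mathbf E\in(0,\infty)^N: V(\mathbf E)\le M_0\}$, let $\mathbf E_k=\mathbf E_{kh}$ be the time-$h$ sampling chain (with kernel $P^h$), let $T_1=\inf\{k>0:\mathbf E_k\in G\}$, and let $\hat P(\mathbf E,\cdot)=\mathbb P_{\mathbf E}[T_1<\infty,\ \mathbf E_{T_1}\in\cdot\,]$ be the kernel of the $G$-induced chain. **Theorem.** There are $\eta_0,h_0>0$, depending only on $N,T_L,T_R,K$, such that for all $0<\eta<\eta_0$ and $0<h<h_0$ an admissible level exists, and for every admissible level $M_0$ the following hold. First, $T_1<\infty$ $\mathbb P_{\mathbf E}$-almost surely for every $\mathbf E\in(0,\infty)^N$, so that $\hat P$ is a Markov kernel. Second, there are constants $M_1>1$ and $\delta>0$ such that $$\hat P W(\mathbf E)\le(1-\delta)\,W(\mathbf E)\qquad\text{for every }\mathbf E\in G\text{ with }W(\mathbf E)>M_1 .$$ -/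

import Mathlib

open MeasureTheory ProbabilityTheory
open scoped ENNReal NNReal

noncomputable section

namespace EnergyExchange

/-! ### State space and elementary laws -/

/-- Strictly positive real numbers: site energies, bath temperatures, the cap `K` on the rates. -/
abbrev PosReal : Type := {x : ℝ // 0 < x}

/-- The open unit interval, where the redistribution parameter `p` lives. -/
abbrev UnitOpen : Type := {p : ℝ // p ∈ Set.Ioo (0 : ℝ) 1}

/-- Energy configurations of a chain of `N = n + 1 ≥ 1` sites, i.e. points of `(0, ∞) ^ N`;
site `i ∈ {1, …, N}` is the index `i - 1`. -/
abbrev Config (n : ℕ) : Type := Fin (n + 1) → PosReal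

/-- The uniform distribution on `(0, 1)`. -/
def uniformLaw : Measure UnitOpen := (volume : Measure ℝ).comap Subtype.val

/-- The exponential distribution with mean `T`, as a law on `(0, ∞)`. -/
def expLaw (T : PosReal) : Measure PosReal := (expMeasure (T : ℝ)⁻¹).comap Subtype.val

instance : IsProbabilityMeasure uniformLaw := ⟨by
  refine ((MeasurableEmbedding.subtype_coe measurableSet_Ioo).comap_apply volume _).trans ?_
  rw [Set.image_univ, Subtype.range_coe]
  simp⟩

instance (T : PosReal) : IsProbabilityMeasure (expLaw T) := ⟨by
  have hr : 0 < (T : ℝ)⁻¹ := inv_pos.2 T.2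
  have := isProbabilityMeasure_expMeasure hr
  have h0 : expMeasure (T : ℝ)⁻¹ (Set.Iic 0) = 0 := by
    have := cdf_expMeasure_eq hr 0
    rw [cdf_eq_real] at this
    simpa [measureReal_def, ENNReal.toReal_eq_zero_iff] using this
  have h1 : (Subtype.val '' (Set.univ : Set PosReal)) = (Set.Iic (0 : ℝ))ᶜ := by
    ext x; simp
  refine ((MeasurableEmbedding.subtype_coe (measurableSet_Ioi (a := (0 : ℝ)))).comap_apply
    (expMeasure (T : ℝ)⁻¹) _).trans ?_
  refine (congrArg _ h1).trans ((prob_compl_eq_one_iff measurableSet_Iic).2 h0)⟩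

/-! ### Exchange events -/

/-- The stochastic energy exchange rate `R(x, y) = min {K, √(min (x, y))}`. -/
def rate (K x y : PosReal) : ℝ := min (K : ℝ) (Real.sqrt (min (x : ℝ) (y : ℝ)))

variable {n : ℕ}

/-- Exchange between the adjacent sites `i` and `i + 1`: their pooled energy `s` is redistributed
as `(p s, (1 - p) s)`. -/
def mix (i : Fin n) (E : Config n) (p : UnitOpen) : Config n :=
  Function.update
    (Function.update E i.castSucc
      ⟨p * ((E i.castSucc : ℝ) + E i.succ),
        mul_pos p.2.1 (add_pos (E i.castSucc).2 (E i.succ).2)⟩)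
    i.succ
    ⟨(1 - p) * ((E i.castSucc : ℝ) + E i.succ),
      mul_pos (sub_pos.2 p.2.2) (add_pos (E i.castSucc).2 (E i.succ).2)⟩

/-- Exchange between site `k` and a heat bath which offers the energy `x`: the new energy of the
site is `p (E_k + x)`. -/
def bathMix (k : Fin (n + 1)) (E : Config n) (p : UnitOpen) (x : PosReal) : Config n :=
  Function.update E k ⟨p * ((E k : ℝ) + x), mul_pos p.2.1 (add_pos (E k).2 x.2)⟩

lemma measurable_update_config {α : Type*} [MeasurableSpace α] (k : Fin (n + 1))
    {f : α → Config n} {g : α → PosReal} (hf : Measurable f) (hg : Measurable g) :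
    Measurable fun a => Function.update (f a) k (g a) :=
  measurable_update'.comp (hf.prodMk hg)

lemma measurable_mix (i : Fin n) :
    Measurable fun q : Config n × UnitOpen => mix i q.1 q.2 := by
  unfold mix
  refine measurable_update_config _ (measurable_update_config _ measurable_fst ?_) ?_ <;>
  · refine Measurable.subtype_mk ?_
    fun_prop

lemma measurable_bathMix (k : Fin (n + 1)) :
    Measurable fun q : Config n × (UnitOpen × PosReal) => bathMix k q.1 q.2.1 q.2.2 := by
  unfold bathMix
  refine measurable_update_config _ measurable_fst ?_
  refine Measurable.subtype_mk ?_
  fun_prop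

/-- Law of the configuration after an exchange between sites `i` and `i + 1`, `p` uniform. -/
def mixKernel (i : Fin n) : Kernel (Config n) (Config n) :=
  (Kernel.id ×ₖ Kernel.const (Config n) uniformLaw).map fun q => mix i q.1 q.2

/-- Law of the configuration after an exchange between site `k` and a bath of temperature `T`:
`p` uniform and the bath energy exponential with mean `T`, independent. -/
def bathKernel (k : Fin (n + 1)) (T : PosReal) : Kernel (Config n) (Config n) :=
  (Kernel.id ×ₖ Kernel.const (Config n) (uniformLaw.prod (expLaw T))).map
    fun q => bathMix k q.1 q.2.1 q.2.2

instance (i : Fin n) : IsMarkovKernel (mixKernel i) :=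
  Kernel.IsMarkovKernel.map _ (measurable_mix i)

instance (k : Fin (n + 1)) (T : PosReal) : IsMarkovKernel (bathKernel k T) :=
  Kernel.IsMarkovKernel.map _ (measurable_bathMix k)

/-- The infinitesimal generator of the energy exchange process. -/
def generator (TL TR K : PosReal) (f : Config n → ℝ) (E : Config n) : ℝ :=
  (∑ i : Fin n, rate K (E i.castSucc) (E i.succ) * ∫ p, (f (mix i E p) - f E) ∂uniformLaw)
  + rate K TL (E 0) * ∫ q, (f (bathMix 0 E q.1 q.2) - f E) ∂(uniformLaw.prod (expLaw TL))
  + rate K (E (Fin.last n)) TR *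
      ∫ q, (f (bathMix (Fin.last n) E q.1 q.2) - f E) ∂(uniformLaw.prod (expLaw TR))

/-! ### The Markov jump process

All `N + 1 = n + 2` clock rates are at most `K`, so the generator `L` is a bounded operator. With
`Λ = (n + 2) K` one has `L = Λ (J - I)` for the Markov kernel `J` below, hence
`P ^ t = exp (t L) = e ^ (-Λ t) ∑ₘ (Λ t) ^ m / m! J ^ m`. -/

/-- A common bound `Λ` for the sum of all clock rates. -/
def totalCap (n : ℕ) (K : PosReal) : ℝ := (n + 2) * K

/-- The sum of all clock rates at the configuration `E`. -/
def totalRate (TL TR K : PosReal) (E : Config n) : ℝ :=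
  (∑ i : Fin n, rate K (E i.castSucc) (E i.succ)) + rate K TL (E 0) + rate K (E (Fin.last n)) TR

lemma rate_nonneg (K x y : PosReal) : 0 ≤ rate K x y := le_min K.2.le (Real.sqrt_nonneg _)

lemma totalCap_pos (n : ℕ) (K : PosReal) : 0 < totalCap n K :=
  mul_pos (by positivity) K.2

lemma totalRate_le (TL TR K : PosReal) (E : Config n) :
    totalRate TL TR K E ≤ totalCap n K := by
  have h : ∀ x y : PosReal, rate K x y ≤ K := fun x y => min_le_left _ _
  have h1 : (∑ i : Fin n, rate K (E i.castSucc) (E i.succ)) ≤ n * (K : ℝ) := by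
    simpa using Finset.sum_le_sum fun (i : Fin n) (_ : i ∈ Finset.univ) =>
      h (E i.castSucc) (E i.succ)
  have h2 := h TL (E 0)
  have h3 := h (E (Fin.last n)) TR
  unfold totalRate totalCap
  linarith

lemma measurable_rate {α : Type*} [MeasurableSpace α] (K : PosReal) {f g : α → PosReal}
    (hf : Measurable f) (hg : Measurable g) : Measurable fun a => rate K (f a) (g a) := by
  unfold rate
  exact measurable_const.min ((hf.subtype_val.min hg.subtype_val).sqrt)

lemma measurable_totalRate (TL TR K : PosReal) :
    Measurable (totalRate TL TR K : Config n → ℝ) := by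
  unfold totalRate
  refine ((Finset.measurable_sum _ fun i _ => ?_).add ?_).add ?_ <;>
    exact measurable_rate K (by fun_prop) (by fun_prop)

/-- One step of the uniformized jump chain: an exchange takes place across each bond with
probability (rate of the bond) / `Λ`; otherwise nothing happens. -/
def jumpKernel (TL TR K : PosReal) : Kernel (Config n) (Config n) where
  toFun E :=
    (∑ i : Fin n, ENNReal.ofReal (rate K (E i.castSucc) (E i.succ) / totalCap n K) • mixKernel i E)
    + ENNReal.ofReal (rate K TL (E 0) / totalCap n K) • bathKernel 0 TL E
    + ENNReal.ofReal (rate K (E (Fin.last n)) TR / totalCap n K) • bathKernel (Fin.last n) TR E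
    + ENNReal.ofReal (1 - totalRate TL TR K E / totalCap n K) • Measure.dirac E
  measurable' := by
    refine Measure.measurable_of_measurable_coe _ fun s hs => ?_
    simp only [Measure.coe_add, Measure.coe_finsetSum, Measure.coe_smul, Pi.add_apply,
      Finset.sum_apply, Pi.smul_apply, smul_eq_mul]
    refine (((Finset.measurable_sum _ fun i _ => ?_).add ?_).add ?_).add ?_
    · exact ((measurable_rate K (by fun_prop) (by fun_prop)).div_const _).ennreal_ofReal.mul
        (Kernel.measurable_coe _ hs)
    · exact ((measurable_rate K (by fun_prop) (by fun_prop)).div_const _).ennreal_ofReal.mul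
        (Kernel.measurable_coe _ hs)
    · exact ((measurable_rate K (by fun_prop) (by fun_prop)).div_const _).ennreal_ofReal.mul
        (Kernel.measurable_coe _ hs)
    · exact ((measurable_totalRate TL TR K).div_const _ |>.const_sub 1).ennreal_ofReal.mul
        (Measure.measurable_coe hs |>.comp Measure.measurable_dirac)

instance (TL TR K : PosReal) : IsMarkovKernel (jumpKernel TL TR K : Kernel (Config n) _) :=
  ⟨fun E => ⟨by
    have hc := totalCap_pos n K
    have h0 : ∀ x y : PosReal, 0 ≤ rate K x y / totalCap n K :=
      fun x y => div_nonneg (rate_nonneg K x y) hc.le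
    have h1 : 0 ≤ 1 - totalRate TL TR K E / totalCap n K :=
      sub_nonneg.2 ((div_le_one hc).2 (totalRate_le TL TR K E))
    simp only [jumpKernel, Kernel.coe_mk, Measure.coe_add, Measure.coe_finsetSum,
      Measure.coe_smul, Pi.add_apply, Finset.sum_apply, Pi.smul_apply, smul_eq_mul, measure_univ,
      mul_one]
    rw [← ENNReal.ofReal_sum_of_nonneg fun i _ => h0 _ _,
      ← ENNReal.ofReal_add (Finset.sum_nonneg fun i _ => h0 _ _) (h0 _ _),
      ← ENNReal.ofReal_add (add_nonneg (Finset.sum_nonneg fun i _ => h0 _ _) (h0 _ _)) (h0 _ _),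
      ← ENNReal.ofReal_add (add_nonneg (add_nonneg (Finset.sum_nonneg fun i _ => h0 _ _)
        (h0 _ _)) (h0 _ _)) h1, ← Finset.sum_div, ← add_div, ← add_div]
    simp [totalRate]⟩⟩

instance instIsMarkovKernelPow {α : Type*} [MeasurableSpace α] (κ : Kernel α α)
    [IsMarkovKernel κ] (m : ℕ) : IsMarkovKernel (κ ^ m) := by
  induction m with
  | zero => rw [pow_zero]; exact inferInstanceAs (IsMarkovKernel Kernel.id)
  | succ m ih => rw [pow_succ]; exact inferInstanceAs (IsMarkovKernel ((κ ^ m) ∘ₖ κ))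

/-- The transition kernel `P ^ t` of the energy exchange process: `exp (t L)`, written through the
uniformized jump chain. -/
def transition (TL TR K : PosReal) (t : ℝ≥0) : Kernel (Config n) (Config n) where
  toFun E := Measure.sum fun m : ℕ =>
    ENNReal.ofReal (Real.exp (-(totalCap n K * t)) * (totalCap n K * t) ^ m / m.factorial) •
      (jumpKernel TL TR K ^ m) E
  measurable' := by
    refine Measure.measurable_of_measurable_coe _ fun s hs => ?_
    simp only [Measure.sum_apply _ hs, Measure.coe_smul, Pi.smul_apply, smul_eq_mul]
    exact Measurable.tsum fun m => (Kernel.measurable_coe _ hs).const_mul _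

instance (TL TR K : PosReal) (t : ℝ≥0) :
    IsMarkovKernel (transition TL TR K t : Kernel (Config n) _) :=
  ⟨fun E => ⟨by
    have hc : 0 ≤ totalCap n K * t := mul_nonneg (totalCap_pos n K).le t.2
    have h : HasSum (fun m : ℕ => Real.exp (-(totalCap n K * t)) * (totalCap n K * t) ^ m /
        m.factorial) 1 := hasSum_one_poissonMeasure ⟨totalCap n K * t, hc⟩
    have h' : ∑' m : ℕ, ENNReal.ofReal
        (Real.exp (-(totalCap n K * t)) * (totalCap n K * t) ^ m / m.factorial) = 1 := by
      rw [← ENNReal.ofReal_tsum_of_nonneg (fun m => by positivity) h.summable, h.tsum_eq,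
        ENNReal.ofReal_one]
    simpa [transition, Measure.sum_apply] using h'⟩⟩

section Kolmogorov

variable {f : Config n → ℝ} {C : ℝ}

lemma integrable_of_bounded {α : Type*} [MeasurableSpace α] (μ : Measure α) [IsFiniteMeasure μ]
    {f : α → ℝ} {C : ℝ} (hf : Measurable f) (hC : ∀ a, |f a| ≤ C) : Integrable f μ :=
  Integrable.of_bound hf.aestronglyMeasurable C (ae_of_all _ hC)

lemma integral_mixKernel (i : Fin n) (hf : Measurable f) (hC : ∀ E, |f E| ≤ C) (E : Config n) :
    ∫ E', f E' ∂(mixKernel i E) = ∫ p, (f (mix i E p) - f E) ∂uniformLaw + f E := by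
  have hm : Measurable fun p => f (mix i E p) :=
    hf.comp ((measurable_mix i).comp measurable_prodMk_left)
  rw [integral_sub (integrable_of_bounded _ hm fun p => hC _) (integrable_const _),
    mixKernel, Kernel.map_apply _ (measurable_mix i),
    integral_map (measurable_mix i).aemeasurable hf.aestronglyMeasurable,
    Kernel.prod_apply, Kernel.id_apply, Kernel.const_apply, Measure.dirac_prod,
    integral_const, probReal_univ, one_smul, sub_add_cancel]
  exact integral_map measurable_prodMk_left.aemeasurable
    (hf.comp (measurable_mix i)).aestronglyMeasurable

lemma integral_bathKernel (k : Fin (n + 1)) (T : PosReal) (hf : Measurable f)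
    (hC : ∀ E, |f E| ≤ C) (E : Config n) :
    ∫ E', f E' ∂(bathKernel k T E) =
      ∫ q, (f (bathMix k E q.1 q.2) - f E) ∂(uniformLaw.prod (expLaw T)) + f E := by
  have hm : Measurable fun q : UnitOpen × PosReal => f (bathMix k E q.1 q.2) :=
    hf.comp ((measurable_bathMix k).comp measurable_prodMk_left)
  rw [integral_sub (integrable_of_bounded _ hm fun p => hC _) (integrable_const _),
    bathKernel, Kernel.map_apply _ (measurable_bathMix k),
    integral_map (measurable_bathMix k).aemeasurable hf.aestronglyMeasurable,
    Kernel.prod_apply, Kernel.id_apply, Kernel.const_apply, Measure.dirac_prod,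
    integral_const, probReal_univ, one_smul, sub_add_cancel]
  exact integral_map measurable_prodMk_left.aemeasurable
    (hf.comp (measurable_bathMix k)).aestronglyMeasurable

/-- `J = I + L / Λ`. -/
lemma integral_jumpKernel (TL TR K : PosReal) (hf : Measurable f) (hC : ∀ E, |f E| ≤ C)
    (E : Config n) :
    ∫ E', f E' ∂(jumpKernel TL TR K E) = f E + generator TL TR K f E / totalCap n K := by
  have hc := totalCap_pos n K
  have h0 : ∀ x y : PosReal, 0 ≤ rate K x y / totalCap n K :=
    fun x y => div_nonneg (rate_nonneg K x y) hc.le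
  have h1 : 0 ≤ 1 - totalRate TL TR K E / totalCap n K :=
    sub_nonneg.2 ((div_le_one hc).2 (totalRate_le TL TR K E))
  have hi : ∀ (r : ℝ) (μ : Measure (Config n)) [IsFiniteMeasure μ],
      Integrable f (ENNReal.ofReal r • μ) := fun r μ _ =>
    (integrable_of_bounded μ hf hC).smul_measure ENNReal.ofReal_ne_top
  simp only [jumpKernel, Kernel.coe_mk]
  rw [integral_add_measure (((integrable_finsetSum_measure.2 fun i _ => hi _ _).add_measure
      (hi _ _)).add_measure (hi _ _)) (hi _ _),
    integral_add_measure ((integrable_finsetSum_measure.2 fun i _ => hi _ _).add_measure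
      (hi _ _)) (hi _ _),
    integral_add_measure (integrable_finsetSum_measure.2 fun i _ => hi _ _) (hi _ _),
    integral_finsetSum_measure fun i _ => hi _ _]
  simp only [integral_smul_measure, integral_dirac' _ _ hf.stronglyMeasurable,
    ENNReal.toReal_ofReal (h0 _ _), ENNReal.toReal_ofReal h1, integral_mixKernel _ hf hC,
    integral_bathKernel _ _ hf hC, smul_eq_mul]
  simp only [generator, totalRate, mul_add, Finset.sum_add_distrib, ← Finset.sum_mul,
    div_mul_eq_mul_div, ← Finset.sum_div]
  ring

lemma abs_integral_le_of_bounded {α : Type*} [MeasurableSpace α] (μ : Measure α)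
    [IsProbabilityMeasure μ] {f : α → ℝ} {C : ℝ} (hC : ∀ a, |f a| ≤ C) : |∫ a, f a ∂μ| ≤ C := by
  simpa using norm_integral_le_of_norm_le_const (μ := μ) (f := f) (ae_of_all _ hC)

lemma integral_transition (TL TR K : PosReal) (hf : Measurable f) (hC : ∀ E, |f E| ≤ C)
    (t : ℝ≥0) (E : Config n) :
    HasSum (fun m : ℕ => Real.exp (-(totalCap n K * t)) * (totalCap n K * t) ^ m / m.factorial *
      ∫ E', f E' ∂((jumpKernel TL TR K ^ m) E)) (∫ E', f E' ∂(transition TL TR K t E)) := by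
  have hc : 0 ≤ totalCap n K * t := mul_nonneg (totalCap_pos n K).le t.2
  have h := hasSum_integral_measure (integrable_of_bounded (transition TL TR K t E) hf hC)
  refine h.congr_fun fun m => ?_
  rw [integral_smul_measure, ENNReal.toReal_ofReal (by positivity), smul_eq_mul]

lemma summable_expSeries {b : ℕ → ℝ} (hb : ∀ m, |b m| ≤ C) (x : ℝ) :
    Summable fun m : ℕ => x ^ m / m.factorial * b m := by
  refine Summable.of_norm_bounded ((Real.summable_pow_div_factorial |x|).mul_right C)
    fun m => ?_
  rw [norm_mul, norm_div, norm_pow, Real.norm_eq_abs, Real.norm_eq_abs, Real.norm_eq_abs,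
    Nat.abs_cast]
  gcongr
  exact hb m

lemma succ_mul_div_factorial (y : ℝ) (m : ℕ) :
    ((m + 1 : ℕ) * y ^ (m + 1 - 1)) / ((m + 1).factorial : ℝ) = y ^ m / m.factorial := by
  rw [Nat.factorial_succ, Nat.add_sub_cancel]
  push_cast
  field_simp

lemma hasDerivAt_expSeries {a : ℕ → ℝ} (haC : ∀ m, |a m| ≤ C) (x : ℝ) :
    HasDerivAt (fun x : ℝ => ∑' m : ℕ, x ^ m / m.factorial * a m)
      (∑' m : ℕ, x ^ m / m.factorial * a (m + 1)) x := by
  have hC0 : 0 ≤ C := (abs_nonneg _).trans (haC 0)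
  have hu : Summable fun m : ℕ => (m * (|x| + 1) ^ (m - 1)) / (m.factorial : ℝ) * C := by
    rw [← summable_nat_add_iff 1]
    simp only [succ_mul_div_factorial]
    exact (Real.summable_pow_div_factorial (|x| + 1)).mul_right C
  have hx : x ∈ Metric.ball (0 : ℝ) (|x| + 1) := by simp
  have hd : HasDerivAt (fun x : ℝ => ∑' m : ℕ, x ^ m / m.factorial * a m)
      (∑' m : ℕ, (m * x ^ (m - 1)) / m.factorial * a m) x := by
    refine hasDerivAt_tsum_of_isPreconnected
      (g := fun (m : ℕ) (y : ℝ) => y ^ m / (m.factorial : ℝ) * a m)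
      (g' := fun (m : ℕ) (y : ℝ) => (m * y ^ (m - 1)) / (m.factorial : ℝ) * a m) hu
      Metric.isOpen_ball (convex_ball _ _).isPreconnected (fun m y _ => ?_) (fun m y hy => ?_) hx
      (summable_expSeries haC x) hx
    · exact ((hasDerivAt_pow m y).div_const _).mul_const _
    · have hy' : |y| ≤ |x| + 1 := by
        simpa using (Metric.mem_ball.1 hy).le
      rw [norm_mul, norm_div, norm_mul, norm_pow, Real.norm_eq_abs, Real.norm_eq_abs,
        Real.norm_eq_abs, Real.norm_eq_abs, Nat.abs_cast, Nat.abs_cast]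
      gcongr
      exact haC m
  have hs : Summable fun m : ℕ => (m * x ^ (m - 1)) / (m.factorial : ℝ) * a m := by
    rw [← summable_nat_add_iff 1]
    simp only [succ_mul_div_factorial]
    exact summable_expSeries (b := fun m => a (m + 1)) (fun m => haC _) x
  rw [hs.tsum_eq_zero_add] at hd
  simpa only [succ_mul_div_factorial, Nat.cast_zero, zero_mul, zero_div, zero_add] using hd

lemma transition_zero (TL TR K : PosReal) :
    (transition TL TR K 0 : Kernel (Config n) (Config n)) = Kernel.id := by
  ext E s hs
  simp only [transition, Kernel.coe_mk, Measure.sum_apply _ hs, Measure.coe_smul, Pi.smul_apply,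
    smul_eq_mul]
  rw [tsum_eq_single 0 fun m hm => by simp [hm]]
  simp only [NNReal.coe_zero, mul_zero, neg_zero, Real.exp_zero, pow_zero, Nat.factorial_zero,
    Nat.cast_one, div_one, mul_one, ENNReal.ofReal_one, one_mul]
  rfl

/-- Kolmogorov's equation; with `P ^ 0 = I` it says that `P ^ t` is the transition semigroup with
generator `L`. -/
theorem hasDerivWithinAt_transition (TL TR K : PosReal) (hf : Measurable f)
    (hC : ∀ E, |f E| ≤ C) (t : ℝ≥0) (E : Config n) :
    HasDerivWithinAt (fun s : ℝ => ∫ E', f E' ∂(transition TL TR K s.toNNReal E))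
      (∫ E', generator TL TR K f E' ∂(transition TL TR K t E)) (Set.Ici 0) t := by
  set Λ := totalCap n K with hΛ
  have hc : 0 < Λ := totalCap_pos n K
  set a : ℕ → ℝ := fun m => ∫ E', f E' ∂((jumpKernel TL TR K ^ m) E) with ha
  have haC : ∀ m, |a m| ≤ C := fun m => abs_integral_le_of_bounded _ hC
  set g : Config n → ℝ := fun E => ∫ E', f E' ∂(jumpKernel TL TR K E) with hg
  have hgm : Measurable g := hf.stronglyMeasurable.integral_kernel.measurable
  have hgC : ∀ E, |g E| ≤ C := fun E => abs_integral_le_of_bounded _ hC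
  have hgen : ∀ E, generator TL TR K f E = Λ * (g E - f E) := fun E => by
    simp only [hg, integral_jumpKernel TL TR K hf hC E, ← hΛ]
    field_simp
    ring
  have hga : ∀ m, ∫ E', g E' ∂((jumpKernel TL TR K ^ m) E) = a (m + 1) := fun m => by
    simp only [ha, hg]
    rw [pow_succ' (jumpKernel TL TR K) m]
    exact (Kernel.integral_comp (η := jumpKernel TL TR K) (κ := jumpKernel TL TR K ^ m)
      (integrable_of_bounded ((jumpKernel TL TR K ∘ₖ (jumpKernel TL TR K ^ m)) E) hf hC)).symm
  have hder := hasDerivAt_expSeries haC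
  have key : ∀ (F : Config n → ℝ) (b : ℕ → ℝ), Measurable F → (∀ E, |F E| ≤ C) →
      (∀ m, ∫ E', F E' ∂((jumpKernel TL TR K ^ m) E) = b m) → ∀ s : ℝ≥0,
      ∫ E', F E' ∂(transition TL TR K s E) =
        Real.exp (-(Λ * s)) * ∑' m : ℕ, (Λ * s) ^ m / m.factorial * b m := by
    intro F b hF hFC hb s
    rw [← (integral_transition TL TR K hF hFC s E).tsum_eq, ← tsum_mul_left]
    refine tsum_congr fun m => ?_
    rw [hb]
    ring
  have hlin : HasDerivAt (fun s : ℝ => Λ * s) Λ t := by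
    simpa using (hasDerivAt_id (t : ℝ)).const_mul Λ
  have hfin : HasDerivAt (fun s : ℝ => Real.exp (-(Λ * s)) *
      ∑' m : ℕ, (Λ * s) ^ m / m.factorial * a m)
      (∫ E', generator TL TR K f E' ∂(transition TL TR K t E)) t := by
    convert! hlin.neg.exp.mul ((hder (Λ * t)).comp (t : ℝ) hlin) using 1
    simp only [hgen]
    rw [integral_const_mul, integral_sub (integrable_of_bounded _ hgm hgC)
      (integrable_of_bounded _ hf hC), key g (fun m => a (m + 1)) hgm hgC hga t,
      key f a hf hC (fun m => rfl) t]
    simp only [Pi.neg_apply, Function.comp_apply]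
    ring
  refine hfin.hasDerivWithinAt.congr (fun s hs => ?_) ?_
  · rw [key f a hf hC (fun m => rfl), Real.coe_toNNReal s hs]
  · rw [key f a hf hC (fun m => rfl), Real.toNNReal_coe]

end Kolmogorov

/-! ### Discrete-time Markov chains, return times, induced chains -/

section Chain

variable {X : Type*} [MeasurableSpace X]

/-- `pathLaw κ x` is the law, on the space of trajectories `ω : ℕ → X`, of the time-homogeneous
Markov chain with transition kernel `κ` started at `ω 0 = x`. -/
def pathLaw (κ : Kernel X X) [IsMarkovKernel κ] : Kernel X (ℕ → X) :=
  (Kernel.traj (X := fun _ => X)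
    (fun m => κ.comap (fun x : (_ : Finset.Iic m) → X => x ⟨m, Finset.mem_Iic.2 le_rfl⟩)
      (measurable_pi_apply _)) 0).comap
    (fun x _ => x) (measurable_pi_lambda _ fun _ => measurable_id)

instance (κ : Kernel X X) [IsMarkovKernel κ] : IsMarkovKernel (pathLaw κ) := by
  unfold pathLaw; infer_instance

/-- The first return time `inf {k > 0 | ω k ∈ A}` of a trajectory to `A` (`⊤` if there is none). -/
def returnTime (A : Set X) (ω : ℕ → X) : ℕ∞ := hittingAfter (fun k (ω : ℕ → X) => ω k) A 1 ω

lemma measurableSet_returnTime_le {A : Set X} (hA : MeasurableSet A) (m : ℕ) :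
    MeasurableSet {ω : ℕ → X | returnTime A ω ≤ m} := by
  have : {ω : ℕ → X | returnTime A ω ≤ m} = ⋃ k ∈ Set.Icc 1 m, (fun ω : ℕ → X => ω k) ⁻¹' A := by
    ext ω
    simp only [Set.mem_ofPred_eq, Set.mem_iUnion, Set.mem_preimage, exists_prop]
    exact hittingAfter_le_iff
  rw [this]
  exact MeasurableSet.biUnion (Set.to_countable _) fun k _ => measurable_pi_apply k hA

lemma measurableSet_returnTime_lt_top {A : Set X} (hA : MeasurableSet A) :
    MeasurableSet {ω : ℕ → X | returnTime A ω < ⊤} := by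
  have : {ω : ℕ → X | returnTime A ω < ⊤} = ⋃ m : ℕ, {ω : ℕ → X | returnTime A ω ≤ m} := by
    ext ω
    simp only [Set.mem_ofPred_eq, Set.mem_iUnion]
    exact ⟨fun h => ⟨(returnTime A ω).toNat, (ENat.natCast_toNat h.ne).ge⟩,
      fun ⟨m, hm⟩ => hm.trans_lt (ENat.natCast_lt_top m)⟩
  rw [this]
  exact MeasurableSet.iUnion fun m => measurableSet_returnTime_le hA m

/-- The position `ω (T₁)` at the first return time `T₁` to `A` (used where `T₁ < ∞`). -/
def returnPosition (A : Set X) (ω : ℕ → X) : X := ω (returnTime A ω).toNat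

lemma measurable_returnPosition {A : Set X} (hA : MeasurableSet A) :
    Measurable (returnPosition A) := by
  have h : Measurable fun ω : ℕ → X => (returnTime A ω).toNat := by
    refine measurable_of_Iic fun m => ?_
    have : (fun ω : ℕ → X => (returnTime A ω).toNat) ⁻¹' Set.Iic m =
        {ω | returnTime A ω ≤ m} ∪ {ω | returnTime A ω < ⊤}ᶜ := by
      ext ω
      simp only [Set.mem_preimage, Set.mem_Iic, Set.mem_union, Set.mem_compl_iff,
        Set.mem_ofPred_eq]
      generalize returnTime A ω = T
      induction T using ENat.recTopCoe <;> simp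
    rw [this]
    exact (measurableSet_returnTime_le hA m).union (measurableSet_returnTime_lt_top hA).compl
  have h2 : Measurable fun q : (ℕ → X) × ℕ => q.1 q.2 :=
    measurable_from_prod_countable_left fun m => measurable_pi_apply m
  exact h2.comp (measurable_id.prodMk h)

/-- The kernel of the chain induced by `κ` on `A`: the law of the position at the first return
time to `A`, `(x, S) ↦ ℙ_x [T₁ < ∞, ω (T₁) ∈ S]`. -/
def inducedKernel (κ : Kernel X X) [IsMarkovKernel κ] {A : Set X} (hA : MeasurableSet A) :
    Kernel X X :=
  ((pathLaw κ).restrict (measurableSet_returnTime_lt_top hA)).map (returnPosition A)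

end Chain

/-! ### The energy functionals -/

/-- The total energy `W`. -/
def totalEnergy (E : Config n) : ℝ := ∑ i, (E i : ℝ)

/-- The exponents `a_m = 1 - (2 ^ (m - 1) - 1) / (2 ^ N - 1)`, `1 ≤ m ≤ N`. -/
def coeff (N m : ℕ) : ℝ := 1 - ((2 : ℝ) ^ (m - 1) - 1) / ((2 : ℝ) ^ N - 1)

/-- `V_η(E)`: the sum over all blocks `i, i + 1, …, j` of consecutive sites of
`(E_i + ⋯ + E_j) ^ (a_m η - 1)`, where `m = j - i + 1` is the length of the block. -/
def lowEnergy (η : ℝ) (E : Config n) : ℝ :=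
  ∑ i : Fin (n + 1), ∑ j ∈ Finset.Ici i,
    (∑ k ∈ Finset.Icc i j, (E k : ℝ)) ^ (coeff (n + 1) ((j : ℕ) - i + 1) * η - 1)

lemma measurable_lowEnergy (η : ℝ) : Measurable (lowEnergy η : Config n → ℝ) := by
  unfold lowEnergy
  refine Finset.measurable_sum _ fun i _ => Finset.measurable_sum _ fun j _ => ?_
  refine Measurable.pow_const (Finset.measurable_sum _ fun k _ => ?_) _
  fun_prop

/-- The active set `G = {V_η ≤ M₀}`. -/
def activeSet (n : ℕ) (η M₀ : ℝ) : Set (Config n) := {E | lowEnergy η E ≤ M₀}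

lemma measurableSet_activeSet (n : ℕ) (η M₀ : ℝ) : MeasurableSet (activeSet n η M₀) :=
  measurable_lowEnergy η measurableSet_Iic

/-- `M₀ > 1` is an admissible level for the parameters `η`, `h`: with `α = 1 - 1 / (2 (1 - η))`
there is `c₀ > 0` such that `P ^ h V - V ≤ - c₀ V ^ α` on `{V > M₀}`, `V = V_η`. -/
def IsDriftLevel (n : ℕ) (TL TR K : PosReal) (η : ℝ) (h : ℝ≥0) (M₀ : ℝ) : Prop :=
  1 < M₀ ∧ ∃ c₀ : ℝ, 0 < c₀ ∧ ∀ E : Config n, M₀ < lowEnergy η E →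
    ∫⁻ E', ENNReal.ofReal (lowEnergy η E') ∂(transition TL TR K h E) ≤
      ENNReal.ofReal (lowEnergy η E - c₀ * lowEnergy η E ^ (1 - 1 / (2 * (1 - η))))

end EnergyExchange

end

open MeasureTheory ProbabilityTheory
open scoped ENNReal NNReal

noncomputable section

namespace EnergyExchange

/-! The proof is a Foster–Lyapunov argument with two functions; write `N = n + 1`. On `G` every
one-site term `E_k ^ (η - 1)` of `V` is at most `M₀`, so every site has energy at least `M₀ ^ (-1 /
(1 - η))` and the rates are bounded below. Some site carries at least `W / N`, and on average a
fixed share of this energy is handed, site by site, to the left bath within time `h`. Hence `P^h W ≤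
(1 - δ) W + C_W` on `G` (`exists_transition_totalEnergy_le`).

Outside `G` cold sites may block the transport, and only `P^h W ≤ W + C_W` remains. The steps spent
there are paid for by `V`: admissibility gives `P^h V ≤ V - c` off `G`, so with `b = C_W / c` the
function `F = W + b V` satisfies `P^h F ≤ F` off `G`. Optional stopping at `T₁` then yields `P̂ W ≤
P^h F` (`lintegral_inducedKernel_le`). On `G`, `P^h F` exceeds `P^h W` by at most a constant, so the
contraction survives for large `W`. The drift of `V` also gives `T₁ < ∞` (`ae_returnTime_lt_top`).

An admissible level exists because `V` itself has a drift of order `-V ^ α`. An exchange across an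
end of a block of length `m` leaves it with at least `p` (or `1 - p`) times the sum `t` of the block
enlarged by one site. The mean of `(p t) ^ s` is `t ^ s / (s + 1)`, the rate is at most `√t`, and `t
^ (a_{m+1} η - 1) ≤ V` because the enlarged block also occurs in `V`. So the gain is of order `V ^
((1/2 - a_m η) / (1 - a_{m+1} η))` plus a constant, and the `a_m` are chosen to make this exponent
smaller than `α` (`gainExponent_lt`, `exists_mix_gain_le`). Against this, some block term is at
least `V / N ^ 2`. For large `V` the exchange at the right end of that block has rate at least `V ^
(-1 / (2 (1 - η)))` and makes the term negligible, a loss of order `V ^ α` (`exists_loss_le`).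

Both drifts are computed for one step of `jumpKernel` and carried to `P^h` by Poisson averaging
(`exists_transition_drift`). All means are lower integrals in `ℝ≥0∞`, so integrability never has to
be discussed; losses are therefore added on the left instead of subtracted on the right. -/

variable {n : ℕ}

/-! ### Return times, optional stopping and the induced kernel. -/

section Chain

variable {X : Type*}

/-- Trajectories which avoid `A` at the times `1, …, m`. -/
def avoidUpTo (A : Set X) (m : ℕ) : Set (ℕ → X) := {ω | ∀ k, 1 ≤ k → k ≤ m → ω k ∉ A}

lemma avoidUpTo_succ (A : Set X) (m : ℕ) :
    avoidUpTo A (m + 1) = avoidUpTo A m \ {ω | ω (m + 1) ∈ A} := by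
  ext ω
  simp only [avoidUpTo, Set.mem_ofPred_eq, Set.mem_sdiff]
  refine ⟨fun h => ⟨fun k h1 h2 => h k h1 (by lia), h _ (by lia) le_rfl⟩, fun h k h1 h2 => ?_⟩
  rcases Nat.le_succ_iff.1 h2 with h3 | rfl
  · exact h.1 k h1 h3
  · exact h.2

/-- Splits a finite return time according to its value `m + 1`. The pieces are disjoint, which turns
integrals against `inducedKernel` into series over `m`. -/
lemma returnTime_lt_top_iff {A : Set X} {ω : ℕ → X} :
    returnTime A ω < ⊤ ↔ ∃ m, ω ∈ avoidUpTo A m ∩ {ω | ω (m + 1) ∈ A} := by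
  have hle : ∀ m : ℕ, returnTime A ω ≤ m ↔ ∃ k ∈ Set.Icc 1 m, ω k ∈ A :=
    fun m => hittingAfter_le_iff
  constructor
  · intro h
    have h' : ∃ m : ℕ, ω (m + 1) ∈ A := by
      obtain ⟨k, hk, hkA⟩ := (hle (returnTime A ω).toNat).1 (ENat.natCast_toNat h.ne).ge
      exact ⟨k - 1, by rwa [Nat.sub_add_cancel hk.1]⟩
    classical
    refine ⟨Nat.find h', fun k h1 h2 hk => ?_, Nat.find_spec h'⟩
    exact Nat.find_min h' (m := k - 1) (by lia) (by rwa [Nat.sub_add_cancel h1])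
  · rintro ⟨m, -, hm⟩
    exact ((hle (m + 1)).2 ⟨m + 1, ⟨by lia, le_rfl⟩, hm⟩).trans_lt (ENat.natCast_lt_top _)

lemma returnPosition_eq {A : Set X} {ω : ℕ → X} {m : ℕ}
    (h : ω ∈ avoidUpTo A m ∩ {ω | ω (m + 1) ∈ A}) : returnPosition A ω = ω (m + 1) := by
  have hle : ∀ m : ℕ, returnTime A ω ≤ m ↔ ∃ k ∈ Set.Icc 1 m, ω k ∈ A :=
    fun m => hittingAfter_le_iff
  have h1 : returnTime A ω = (m + 1 : ℕ) := by
    refine le_antisymm ((hle (m + 1)).2 ⟨m + 1, ⟨by lia, le_rfl⟩, h.2⟩) ?_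
    by_contra hlt
    have : returnTime A ω ≤ m := by
      rw [not_le] at hlt
      push_cast at hlt
      exact Order.le_of_lt_add_one hlt
    obtain ⟨k, hk, hkA⟩ := (hle m).1 this
    exact h.1 k hk.1 hk.2 hkA
  rw [returnPosition, h1, ENat.toNat_natCast]

variable [MeasurableSpace X]

lemma lintegral_pathLaw_zero (κ : Kernel X X) [IsMarkovKernel κ] {f : X → ℝ≥0∞}
    (hf : Measurable f) (x : X) : ∫⁻ ω, f (ω 0) ∂(pathLaw κ x) = f x := by
  rw [pathLaw, Kernel.comap_apply,
    Kernel.lintegral_traj (X := fun _ => X) _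
      (show Measurable fun ω : ℕ → X => f (ω 0) from hf.comp (measurable_pi_apply 0))]
  simp [Function.updateFinset]

/-- The Markov property at time `m`. -/
lemma lintegral_pathLaw_succ (κ : Kernel X X) [IsMarkovKernel κ] (m : ℕ)
    {g : ((_ : Finset.Iic m) → X) → ℝ≥0∞} (hg : Measurable g) {f : X → ℝ≥0∞}
    (hf : Measurable f) (x : X) :
    ∫⁻ ω, g (Preorder.frestrictLe m ω) * f (ω (m + 1)) ∂(pathLaw κ x) =
      ∫⁻ ω, g (Preorder.frestrictLe m ω) * ∫⁻ y, f y ∂(κ (ω m)) ∂(pathLaw κ x) := by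
  set η : (m : ℕ) → Kernel ((_ : Finset.Iic m) → X) X := fun m =>
    κ.comap (fun x : (_ : Finset.Iic m) → X => x ⟨m, Finset.mem_Iic.2 le_rfl⟩)
      (measurable_pi_apply _) with hη
  have hgm : Measurable fun ω : ℕ → X => g (Preorder.frestrictLe (π := fun _ => X) m ω) :=
    hg.comp (Preorder.measurable_frestrictLe m)
  have hκ : Measurable fun y => ∫⁻ z, f z ∂(κ y) := hf.lintegral_kernel
  -- Disintegration at time `m`: `partialTraj` gives the past, and `traj` started at `m` continues
  -- it with the past frozen, so that `g` factors out of the inner integral.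
  have key : ∀ F : (ℕ → X) → ℝ≥0∞, Measurable F → ∀ u,
      ∫⁻ ω, F ω ∂(Kernel.traj (X := fun _ => X) η 0 u) =
        ∫⁻ y, ∫⁻ ω, F ω ∂(Kernel.traj (X := fun _ => X) η m y)
          ∂(Kernel.partialTraj (X := fun _ => X) η 0 m u) := by
    intro F hF u
    rw [← Kernel.traj_comp_partialTraj (X := fun _ => X) (Nat.zero_le m),
      Kernel.lintegral_comp _ _ _ hF]
  have frestr : ∀ (ω : ℕ → X) (y : (_ : Finset.Iic m) → X),
      Preorder.frestrictLe (π := fun _ => X) m (Function.updateFinset ω (Finset.Iic m) y) = y := by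
    intro ω y
    ext i
    simp [Function.updateFinset, Preorder.frestrictLe]
  have hm1 : Measurable fun ω : ℕ → X =>
      g (Preorder.frestrictLe (π := fun _ => X) m ω) * f (ω (m + 1)) :=
    hgm.mul (hf.comp (measurable_pi_apply _))
  have hm2 : Measurable fun ω : ℕ → X =>
      g (Preorder.frestrictLe (π := fun _ => X) m ω) * ∫⁻ y, f y ∂(κ (ω m)) :=
    hgm.mul (hκ.comp (measurable_pi_apply _))
  rw [pathLaw, Kernel.comap_apply]
  refine (key _ hm1 _).trans (Eq.trans ?_ (key _ hm2 _).symm)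
  refine lintegral_congr fun y => ?_
  rw [Kernel.lintegral_traj _ hm1, Kernel.lintegral_traj _ hm2]
  simp only [frestr]
  have h1 : ∀ ω : ℕ → X, Function.updateFinset ω (Finset.Iic m) y (m + 1) = ω (m + 1) := by
    intro ω; simp [Function.updateFinset]
  have h2 : ∀ ω : ℕ → X, Function.updateFinset ω (Finset.Iic m) y m =
      y ⟨m, Finset.mem_Iic.2 le_rfl⟩ := by
    intro ω; simp [Function.updateFinset]
  simp only [h1, h2]
  rw [lintegral_const_mul _ (show Measurable fun ω : ℕ → X => f (ω (m + 1)) from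
    hf.comp (measurable_pi_apply _)), lintegral_const, measure_univ,
    mul_one]
  congr 1
  have := Kernel.map_traj_succ_self (X := fun _ => X) (κ := η) (a := m)
  have h3 : ∫⁻ z, f z ∂(η m y) = ∫⁻ ω, f (ω (m + 1)) ∂(Kernel.traj (X := fun _ => X) η m y) := by
    rw [← this, Kernel.map_apply _ (measurable_pi_apply _),
      lintegral_map hf (measurable_pi_apply _)]
  rw [← h3, hη, Kernel.comap_apply]

lemma measurableSet_avoidUpTo {A : Set X} (hA : MeasurableSet A) (m : ℕ) :
    MeasurableSet (avoidUpTo A m) := by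
  have : avoidUpTo A m = ⋂ k ∈ Set.Icc 1 m, ((fun ω : ℕ → X => ω k) ⁻¹' A)ᶜ := by
    ext ω
    simp [avoidUpTo]
  rw [this]
  exact MeasurableSet.biInter (Set.to_countable _) fun k _ => (measurable_pi_apply k hA).compl

lemma setLIntegral_avoidUpTo_succ (κ : Kernel X X) [IsMarkovKernel κ] {A : Set X}
    (hA : MeasurableSet A) (m : ℕ) {f : X → ℝ≥0∞} (hf : Measurable f) (x : X) :
    ∫⁻ ω in avoidUpTo A m, f (ω (m + 1)) ∂(pathLaw κ x) =
      ∫⁻ ω in avoidUpTo A m, ∫⁻ y, f y ∂(κ (ω m)) ∂(pathLaw κ x) := by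
  -- Avoidance up to time `m` depends only on the coordinates up to `m`; `B` is the same event on
  -- that finite product.
  set B : Set ((_ : Finset.Iic m) → X) := {y | ∀ k : Finset.Iic m, 1 ≤ (k : ℕ) → y k ∉ A} with hB
  have hBm : MeasurableSet B := by
    have : B = ⋂ k : Finset.Iic m, {y | 1 ≤ (k : ℕ) → y k ∉ A} := by
      ext y; simp [hB]
    rw [this]
    refine MeasurableSet.iInter fun k => ?_
    by_cases hk : 1 ≤ (k : ℕ)
    · simp only [hk, forall_const]
      exact (measurable_pi_apply k hA).compl
    · simp [hk]
  have hpre : ∀ ω : ℕ → X, Preorder.frestrictLe (π := fun _ => X) m ω ∈ B ↔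
      ω ∈ avoidUpTo A m := by
    intro ω
    simp only [hB, avoidUpTo, Set.mem_ofPred_eq]
    exact ⟨fun h k h1 h2 => h ⟨k, Finset.mem_Iic.2 h2⟩ h1,
      fun h k h1 => h k h1 (Finset.mem_Iic.1 k.2)⟩
  have h := lintegral_pathLaw_succ κ m (g := B.indicator 1) (measurable_one.indicator hBm) hf x
  have hind : ∀ (F : (ℕ → X) → ℝ≥0∞) (ω : ℕ → X),
      B.indicator (1 : ((_ : Finset.Iic m) → X) → ℝ≥0∞) (Preorder.frestrictLe (π := fun _ => X) m ω) * F ω =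
        (avoidUpTo A m).indicator F ω := by
    intro F ω
    by_cases hω : ω ∈ avoidUpTo A m
    · simp [hω, (hpre ω).2 hω]
    · simp [hω, mt (hpre ω).1 hω]
  rw [lintegral_congr (hind fun ω => f (ω (m + 1))),
    lintegral_congr (hind fun ω => ∫⁻ y, f y ∂(κ (ω m)))] at h
  rwa [lintegral_indicator (measurableSet_avoidUpTo hA m),
    lintegral_indicator (measurableSet_avoidUpTo hA m)] at h

/-- The supermartingale estimate for a function `F` which decreases, in mean, off `A`. -/
lemma sum_return_add_le (κ : Kernel X X) [IsMarkovKernel κ] {A : Set X} (hA : MeasurableSet A)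
    {f F : X → ℝ≥0∞} (hF : Measurable F) (hfF : ∀ x, f x ≤ F x) {c : ℝ≥0∞}
    (hdrift : ∀ x ∉ A, ∫⁻ y, F y ∂(κ x) + c ≤ F x) (x : X) (M : ℕ) :
    (∑ j ∈ Finset.range (M + 1),
        ∫⁻ ω in avoidUpTo A j ∩ {ω | ω (j + 1) ∈ A}, f (ω (j + 1)) ∂(pathLaw κ x))
      + (∑ j ∈ Finset.range M, c * pathLaw κ x (avoidUpTo A (j + 1)))
      + ∫⁻ ω in avoidUpTo A (M + 1), F (ω (M + 1)) ∂(pathLaw κ x) ≤ ∫⁻ y, F y ∂(κ x) := by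
  have hmA : ∀ k, MeasurableSet {ω : ℕ → X | ω k ∈ A} := fun k => measurable_pi_apply k hA
  -- Split by whether the chain lands in `A` at time `m + 1`: landing is charged `f ≤ F`, and the
  -- surviving mass keeps `F`.
  have step : ∀ m, ∫⁻ ω in avoidUpTo A m ∩ {ω | ω (m + 1) ∈ A}, f (ω (m + 1)) ∂(pathLaw κ x)
      + ∫⁻ ω in avoidUpTo A (m + 1), F (ω (m + 1)) ∂(pathLaw κ x) ≤
        ∫⁻ ω in avoidUpTo A m, ∫⁻ y, F y ∂(κ (ω m)) ∂(pathLaw κ x) := by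
    intro m
    rw [← setLIntegral_avoidUpTo_succ κ hA m hF, avoidUpTo_succ,
      ← lintegral_inter_add_sdiff (μ := pathLaw κ x) _ (avoidUpTo A m) (hmA (m + 1))]
    gcongr
    exact hfF _
  induction M with
  | zero =>
    simp only [zero_add, Finset.sum_range_one, Finset.range_zero, Finset.sum_empty, add_zero]
    refine (step 0).trans ?_
    -- The starting point may lie in `A`, so no drift is available for the first step; this is why
    -- the bound is the mean of `F` after one step and not `F x`.
    refine (setLIntegral_le_lintegral _ _).trans ?_
    rw [lintegral_pathLaw_zero κ (f := fun y => ∫⁻ z, F z ∂(κ y)) hF.lintegral_kernel]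
  | succ M ih =>
    refine le_trans ?_ ih
    rw [Finset.sum_range_succ _ (M + 1), Finset.sum_range_succ _ M,
      Finset.sum_range_succ (fun j => c * pathLaw κ x (avoidUpTo A (j + 1))) M]
    have h1 : ∫⁻ ω in avoidUpTo A (M + 1), ∫⁻ y, F y ∂(κ (ω (M + 1))) ∂(pathLaw κ x)
        + c * pathLaw κ x (avoidUpTo A (M + 1)) ≤
        ∫⁻ ω in avoidUpTo A (M + 1), F (ω (M + 1)) ∂(pathLaw κ x) := by
      rw [← setLIntegral_const, ← lintegral_add_right _ measurable_const]
      refine setLIntegral_mono' (measurableSet_avoidUpTo hA _) fun ω hω => ?_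
      exact hdrift _ (hω _ (by lia) le_rfl)
    refine le_trans ?_ (add_le_add_right h1 _)
    refine le_trans ?_ (add_le_add_right (add_le_add_left (step (M + 1)) _) _)
    apply le_of_eq
    ring

lemma lintegral_inducedKernel (κ : Kernel X X) [IsMarkovKernel κ] {A : Set X}
    (hA : MeasurableSet A) {f : X → ℝ≥0∞} (hf : Measurable f) (x : X) :
    ∫⁻ y, f y ∂(inducedKernel κ hA x) = ∑' j,
      ∫⁻ ω in avoidUpTo A j ∩ {ω | ω (j + 1) ∈ A}, f (ω (j + 1)) ∂(pathLaw κ x) := by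
  have hm : ∀ j, MeasurableSet (avoidUpTo A j ∩ {ω : ℕ → X | ω (j + 1) ∈ A}) := fun j =>
    (measurableSet_avoidUpTo hA j).inter (measurable_pi_apply (j + 1) hA)
  have hU : {ω : ℕ → X | returnTime A ω < ⊤} =
      ⋃ j, avoidUpTo A j ∩ {ω : ℕ → X | ω (j + 1) ∈ A} := by
    ext ω
    simp only [Set.mem_iUnion]
    exact returnTime_lt_top_iff
  have hd : Pairwise (Function.onFun Disjoint
      fun j => avoidUpTo A j ∩ {ω : ℕ → X | ω (j + 1) ∈ A}) := by
    refine (pairwise_disjoint_on _).2 fun i j hij => ?_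
    exact Set.disjoint_left.2 fun ω hi hj => hj.1 (i + 1) (by lia) (by lia) hi.2
  rw [inducedKernel, Kernel.map_apply _ (measurable_returnPosition hA),
    lintegral_map hf (measurable_returnPosition hA), Kernel.restrict_apply, hU,
    lintegral_iUnion hm hd]
  refine tsum_congr fun j => setLIntegral_congr_fun (hm j) fun ω hω => ?_
  simp only [returnPosition_eq hω]

/-- Optional stopping: after one unrestricted step, `F` is a nonnegative supermartingale until the
return to `A`, where it dominates `f`. -/
lemma lintegral_inducedKernel_le (κ : Kernel X X) [IsMarkovKernel κ] {A : Set X}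
    (hA : MeasurableSet A) {f F : X → ℝ≥0∞} (hf : Measurable f) (hF : Measurable F)
    (hfF : ∀ x, f x ≤ F x) (hdrift : ∀ x ∉ A, ∫⁻ y, F y ∂(κ x) ≤ F x) (x : X) :
    ∫⁻ y, f y ∂(inducedKernel κ hA x) ≤ ∫⁻ y, F y ∂(κ x) := by
  rw [lintegral_inducedKernel κ hA hf]
  refine ENNReal.tsum_le_of_sum_range_le fun M => ?_
  have h := sum_return_add_le κ hA hF hfF (c := 0) (by simpa using hdrift) x M
  refine le_trans ?_ (le_trans (le_add_right (le_add_right le_rfl)) h)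
  exact Finset.sum_le_sum_of_subset (Finset.range_mono M.le_succ)

/-- Each step spent off `A` costs `c`. Mass that never returns would pay this infinitely often out
of the finite budget `∫⁻ y, F y ∂(κ x)`. -/
lemma ae_returnTime_lt_top (κ : Kernel X X) [IsMarkovKernel κ] {A : Set X}
    (hA : MeasurableSet A) {F : X → ℝ≥0∞} (hF : Measurable F) {c : ℝ≥0∞} (hc : c ≠ 0)
    (hdrift : ∀ x ∉ A, ∫⁻ y, F y ∂(κ x) + c ≤ F x) (x : X) (hx : ∫⁻ y, F y ∂(κ x) ≠ ⊤) :
    ∀ᵐ ω ∂(pathLaw κ x), returnTime A ω < ⊤ := by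
  rw [ae_iff]
  set S : Set (ℕ → X) := {ω | ¬ returnTime A ω < ⊤} with hS
  have hsub : ∀ j, S ⊆ avoidUpTo A j := by
    intro j ω hω k h1 h2 hk
    refine hω ?_
    have hle : returnTime A ω ≤ k := hittingAfter_le_iff.2 ⟨k, ⟨h1, le_rfl⟩, hk⟩
    exact hle.trans_lt (ENat.natCast_lt_top _)
  have hM : ∀ M : ℕ, M * (c * pathLaw κ x S) ≤ ∫⁻ y, F y ∂(κ x) := by
    intro M
    have h := sum_return_add_le κ hA (f := 0) hF (by simp) hdrift x M
    refine le_trans ?_ (le_trans (le_add_right (le_add_left le_rfl)) h)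
    rw [← nsmul_eq_mul, ← Finset.card_range M, ← Finset.sum_const, Finset.card_range]
    gcongr
    exact hsub _
  have h0 : c * pathLaw κ x S = 0 := by
    by_contra hne
    obtain ⟨M, hlt⟩ := ENNReal.exists_nat_mul_gt hne hx
    exact absurd (hM M) (not_le.2 hlt)
  exact (mul_eq_zero.1 h0).resolve_left hc

end Chain

/-! ### Powers of a kernel and iterated drift inequalities. -/

section Drift

variable {X : Type*} [MeasurableSpace X]

lemma lintegral_pow_succ (κ : Kernel X X) (m : ℕ) {f : X → ℝ≥0∞} (hf : Measurable f) (x : X) :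
    ∫⁻ y, f y ∂((κ ^ (m + 1)) x) = ∫⁻ y, ∫⁻ z, f z ∂(κ y) ∂((κ ^ m) x) := by
  rw [pow_succ' κ m]
  exact Kernel.lintegral_comp κ (κ ^ m) x hf

lemma lintegral_pow_succ' (κ : Kernel X X) (m : ℕ) {f : X → ℝ≥0∞} (hf : Measurable f) (x : X) :
    ∫⁻ y, f y ∂((κ ^ (m + 1)) x) = ∫⁻ y, ∫⁻ z, f z ∂((κ ^ m) y) ∂(κ x) := by
  rw [pow_succ κ m]
  exact Kernel.lintegral_comp (κ ^ m) κ x hf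

lemma lintegral_pow_zero (κ : Kernel X X) {f : X → ℝ≥0∞} (hf : Measurable f) (x : X) :
    ∫⁻ y, f y ∂((κ ^ 0) x) = f x := by
  rw [pow_zero]
  exact lintegral_dirac' x hf

variable (κ : Kernel X X) [IsMarkovKernel κ] {f g : X → ℝ≥0∞} {C : ℝ≥0∞}

lemma lintegral_pow_add_sum_le (hf : Measurable f)
    (h : ∀ x, ∫⁻ y, f y ∂(κ x) + g x ≤ f x + C) (m : ℕ) (x : X) :
    ∫⁻ y, f y ∂((κ ^ m) x) + ∑ k ∈ Finset.range m, ∫⁻ y, g y ∂((κ ^ k) x) ≤ f x + m * C := by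
  induction m with
  | zero =>
    rw [lintegral_pow_zero κ hf]
    simp
  | succ m ih =>
    rw [Finset.sum_range_succ, lintegral_pow_succ κ m hf]
    have h1 : ∫⁻ y, ∫⁻ z, f z ∂(κ y) ∂((κ ^ m) x) + ∫⁻ y, g y ∂((κ ^ m) x) ≤
        ∫⁻ y, f y ∂((κ ^ m) x) + C := by
      rw [← lintegral_add_left hf.lintegral_kernel]
      refine (lintegral_mono h).trans ?_
      rw [lintegral_add_left hf]
      simp
    calc _ = (∫⁻ y, ∫⁻ z, f z ∂(κ y) ∂((κ ^ m) x) + ∫⁻ y, g y ∂((κ ^ m) x))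
          + ∑ k ∈ Finset.range m, ∫⁻ y, g y ∂((κ ^ k) x) := by ring
      _ ≤ (∫⁻ y, f y ∂((κ ^ m) x) + C) + ∑ k ∈ Finset.range m, ∫⁻ y, g y ∂((κ ^ k) x) := by
          gcongr
      _ = (∫⁻ y, f y ∂((κ ^ m) x) + ∑ k ∈ Finset.range m, ∫⁻ y, g y ∂((κ ^ k) x)) + C := by ring
      _ ≤ f x + m * C + C := by gcongr
      _ = _ := by push_cast; ring

end Drift

/-! ### Poisson averaging over the number of jumps. -/

/-- The weights of the uniformized jump chain in the transition kernel: a Poisson law. -/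
def poissonWeight (n : ℕ) (K : PosReal) (t : ℝ≥0) (m : ℕ) : ℝ :=
  Real.exp (-(totalCap n K * t)) * (totalCap n K * t) ^ m / m.factorial

lemma poissonWeight_nonneg (n : ℕ) (K : PosReal) (t : ℝ≥0) (m : ℕ) : 0 ≤ poissonWeight n K t m := by
  have : 0 ≤ totalCap n K * t := mul_nonneg (totalCap_pos n K).le t.2
  unfold poissonWeight; positivity

lemma poissonWeight_pos (n : ℕ) (K : PosReal) {t : ℝ≥0} (ht : 0 < t) (m : ℕ) :
    0 < poissonWeight n K t m := by
  have : 0 < totalCap n K * t := mul_pos (totalCap_pos n K) ht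
  unfold poissonWeight; positivity

lemma tsum_poissonWeight (n : ℕ) (K : PosReal) (t : ℝ≥0) :
    ∑' m, ENNReal.ofReal (poissonWeight n K t m) = 1 := by
  have hc : 0 ≤ totalCap n K * t := mul_nonneg (totalCap_pos n K).le t.2
  have h : HasSum (poissonWeight n K t) 1 := hasSum_one_poissonMeasure ⟨totalCap n K * t, hc⟩
  rw [← ENNReal.ofReal_tsum_of_nonneg (poissonWeight_nonneg n K t) h.summable, h.tsum_eq,
    ENNReal.ofReal_one]

lemma tsum_poissonWeight_mul_ne_top (n : ℕ) (K : PosReal) (t : ℝ≥0) :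
    ∑' m : ℕ, ENNReal.ofReal (poissonWeight n K t m) * m ≠ ⊤ := by
  have hs : Summable fun m : ℕ => poissonWeight n K t m * m := by
    rw [← summable_nat_add_iff 1]
    refine ((Real.summable_pow_div_factorial (totalCap n K * t)).mul_left
      (Real.exp (-(totalCap n K * t)) * (totalCap n K * t))).congr fun m => ?_
    simp only [poissonWeight, Nat.factorial_succ, pow_succ]
    push_cast
    field_simp
  have h : ∀ m : ℕ, ENNReal.ofReal (poissonWeight n K t m) * m =
      ENNReal.ofReal (poissonWeight n K t m * m) := fun m => by
    rw [ENNReal.ofReal_mul (poissonWeight_nonneg n K t m), ENNReal.ofReal_natCast]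
  simp only [h]
  exact hs.tsum_ofReal_ne_top

lemma lintegral_transition (TL TR K : PosReal) (t : ℝ≥0) (f : Config n → ℝ≥0∞) (E : Config n) :
    ∫⁻ E', f E' ∂(transition TL TR K t E) = ∑' m, ENNReal.ofReal (poissonWeight n K t m) *
      ∫⁻ E', f E' ∂((jumpKernel TL TR K ^ m) E) := by
  simp only [transition, Kernel.coe_mk, lintegral_sum_measure, lintegral_smul_measure, smul_eq_mul,
    poissonWeight]

/-- A drift inequality for the jump chain is inherited by the process. -/
lemma exists_transition_drift (TL TR K : PosReal) (t : ℝ≥0) {f g : Config n → ℝ≥0∞} {C : ℝ≥0∞}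
    (hf : Measurable f) (hC : C ≠ ⊤)
    (h : ∀ E, ∫⁻ E', f E' ∂(jumpKernel TL TR K E) + g E ≤ f E + C) :
    ∃ C' : ℝ≥0, ∀ E, ∀ k ≤ n, ∫⁻ E', f E' ∂(transition TL TR K t E)
      + ENNReal.ofReal (poissonWeight n K t (n + 1)) * ∫⁻ E', g E' ∂((jumpKernel TL TR K ^ k) E)
      ≤ f E + C' := by
  -- The error is `C` times the mean number of jumps.
  refine ⟨((∑' m : ℕ, ENNReal.ofReal (poissonWeight n K t m) * m) * C).toNNReal, fun E k hk => ?_⟩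
  rw [ENNReal.coe_toNNReal (ENNReal.mul_ne_top (tsum_poissonWeight_mul_ne_top n K t) hC),
    lintegral_transition]
  set w : ℕ → ℝ≥0∞ := fun m => ENNReal.ofReal (poissonWeight n K t m) with hw
  set J : Kernel (Config n) (Config n) := jumpKernel TL TR K with hJ
  -- Of all accumulated losses, only the one after `k` jumps is kept, and only on the event of
  -- exactly `n + 1` jumps.
  have h1 : w (n + 1) * ∫⁻ E', g E' ∂((J ^ k) E) ≤
      ∑' m, w m * ∑ k ∈ Finset.range m, ∫⁻ E', g E' ∂((J ^ k) E) := by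
    refine le_trans ?_ (ENNReal.le_tsum (n + 1))
    gcongr
    exact Finset.single_le_sum (f := fun k => ∫⁻ E', g E' ∂((J ^ k) E)) (fun _ _ => zero_le)
      (Finset.mem_range.2 (by lia))
  calc _ ≤ ∑' m, w m * ∫⁻ E', f E' ∂((J ^ m) E)
        + ∑' m, w m * ∑ k ∈ Finset.range m, ∫⁻ E', g E' ∂((J ^ k) E) := by gcongr
    _ = ∑' m, w m * (∫⁻ E', f E' ∂((J ^ m) E)
          + ∑ k ∈ Finset.range m, ∫⁻ E', g E' ∂((J ^ k) E)) := by
        rw [← ENNReal.tsum_add]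
        simp only [mul_add]
    _ ≤ ∑' m, w m * (f E + m * C) := by
        refine ENNReal.tsum_le_tsum fun m => mul_le_mul_right ?_ _
        exact lintegral_pow_add_sum_le J hf h m E
    _ = f E + (∑' m, w m * m) * C := by
        simp only [mul_add, ENNReal.tsum_add, ENNReal.tsum_mul_right, ← mul_assoc]
        rw [hw, tsum_poissonWeight, one_mul]

/-! ### Means after one jump. -/

lemma lintegral_mixKernel (i : Fin n) {f : Config n → ℝ≥0∞} (hf : Measurable f) (E : Config n) :
    ∫⁻ E', f E' ∂(mixKernel i E) = ∫⁻ p, f (mix i E p) ∂uniformLaw := by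
  rw [mixKernel, Kernel.map_apply _ (measurable_mix i), lintegral_map hf (measurable_mix i),
    Kernel.prod_apply, Kernel.id_apply, Kernel.const_apply, Measure.dirac_prod]
  exact lintegral_map (hf.comp (measurable_mix i)) measurable_prodMk_left

lemma lintegral_bathKernel (k : Fin (n + 1)) (T : PosReal) {f : Config n → ℝ≥0∞}
    (hf : Measurable f) (E : Config n) :
    ∫⁻ E', f E' ∂(bathKernel k T E) =
      ∫⁻ q, f (bathMix k E q.1 q.2) ∂(uniformLaw.prod (expLaw T)) := by
  rw [bathKernel, Kernel.map_apply _ (measurable_bathMix k),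
    lintegral_map hf (measurable_bathMix k),
    Kernel.prod_apply, Kernel.id_apply, Kernel.const_apply, Measure.dirac_prod]
  exact lintegral_map (hf.comp (measurable_bathMix k)) measurable_prodMk_left

lemma lintegral_jumpKernel (TL TR K : PosReal) {f : Config n → ℝ≥0∞} (hf : Measurable f)
    (E : Config n) :
    ∫⁻ E', f E' ∂(jumpKernel TL TR K E) =
      (∑ i : Fin n, ENNReal.ofReal (rate K (E i.castSucc) (E i.succ) / totalCap n K) *
        ∫⁻ p, f (mix i E p) ∂uniformLaw)
      + ENNReal.ofReal (rate K TL (E 0) / totalCap n K) *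
        ∫⁻ q, f (bathMix 0 E q.1 q.2) ∂(uniformLaw.prod (expLaw TL))
      + ENNReal.ofReal (rate K (E (Fin.last n)) TR / totalCap n K) *
        ∫⁻ q, f (bathMix (Fin.last n) E q.1 q.2) ∂(uniformLaw.prod (expLaw TR))
      + ENNReal.ofReal (1 - totalRate TL TR K E / totalCap n K) * f E := by
  simp only [jumpKernel, Kernel.coe_mk, lintegral_add_measure, lintegral_finsetSum_measure,
    lintegral_smul_measure, smul_eq_mul, lintegral_mixKernel _ hf, lintegral_bathKernel _ _ hf,
    lintegral_dirac' _ hf]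

/-- Upper bounds on the mean of a function after each exchange bound its drift. -/
lemma lintegral_jumpKernel_le (TL TR K : PosReal) {φ : Config n → ℝ} (hφ : Measurable φ)
    (E : Config n) (hφE : 0 ≤ φ E) {A : Fin n → ℝ} {BL BR : ℝ} (hA0 : ∀ i, 0 ≤ A i) (hL0 : 0 ≤ BL)
    (hR0 : 0 ≤ BR) (hA : ∀ i, ∫⁻ p, ENNReal.ofReal (φ (mix i E p)) ∂uniformLaw ≤
      ENNReal.ofReal (A i))
    (hL : ∫⁻ q, ENNReal.ofReal (φ (bathMix 0 E q.1 q.2)) ∂(uniformLaw.prod (expLaw TL)) ≤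
      ENNReal.ofReal BL)
    (hR : ∫⁻ q, ENNReal.ofReal (φ (bathMix (Fin.last n) E q.1 q.2))
      ∂(uniformLaw.prod (expLaw TR)) ≤ ENNReal.ofReal BR) :
    ∫⁻ E', ENNReal.ofReal (φ E') ∂(jumpKernel TL TR K E) ≤
      ENNReal.ofReal (φ E + ((∑ i : Fin n, rate K (E i.castSucc) (E i.succ) * (A i - φ E))
        + rate K TL (E 0) * (BL - φ E) + rate K (E (Fin.last n)) TR * (BR - φ E))
          / totalCap n K) := by
  have hc := totalCap_pos n K
  have h0 : ∀ x y : PosReal, 0 ≤ rate K x y / totalCap n K :=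
    fun x y => div_nonneg (rate_nonneg K x y) hc.le
  have h1 : 0 ≤ 1 - totalRate TL TR K E / totalCap n K :=
    sub_nonneg.2 ((div_le_one hc).2 (totalRate_le TL TR K E))
  rw [lintegral_jumpKernel TL TR K hφ.ennreal_ofReal]
  have hrhs : φ E + ((∑ i : Fin n, rate K (E i.castSucc) (E i.succ) * (A i - φ E))
        + rate K TL (E 0) * (BL - φ E) + rate K (E (Fin.last n)) TR * (BR - φ E))
          / totalCap n K =
      (∑ i : Fin n, rate K (E i.castSucc) (E i.succ) / totalCap n K * A i)
      + rate K TL (E 0) / totalCap n K * BL + rate K (E (Fin.last n)) TR / totalCap n K * BR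
      + (1 - totalRate TL TR K E / totalCap n K) * φ E := by
    simp only [totalRate, mul_sub, Finset.sum_sub_distrib, ← Finset.sum_mul,
      div_mul_eq_mul_div, ← Finset.sum_div]
    field_simp
    ring
  have hs : 0 ≤ ∑ i : Fin n, rate K (E i.castSucc) (E i.succ) / totalCap n K * A i :=
    Finset.sum_nonneg fun i _ => mul_nonneg (h0 _ _) (hA0 i)
  have hl := mul_nonneg (h0 TL (E 0)) hL0
  have hr := mul_nonneg (h0 (E (Fin.last n)) TR) hR0
  rw [hrhs, ENNReal.ofReal_add (by positivity) (mul_nonneg h1 hφE),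
    ENNReal.ofReal_add (by positivity) hr, ENNReal.ofReal_add hs hl,
    ENNReal.ofReal_sum_of_nonneg fun i _ => mul_nonneg (h0 _ _) (hA0 i),
    ENNReal.ofReal_mul (h0 TL (E 0)), ENNReal.ofReal_mul (h0 (E (Fin.last n)) TR),
    ENNReal.ofReal_mul h1]
  simp only [ENNReal.ofReal_mul (h0 _ _)]
  gcongr with i
  exact hA i

/-! ### Moments of the elementary laws -/

lemma lintegral_uniformLaw (f : ℝ → ℝ≥0∞) :
    ∫⁻ p : UnitOpen, f p ∂uniformLaw = ∫⁻ x in Set.Ioo (0 : ℝ) 1, f x :=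
  lintegral_subtype_comap measurableSet_Ioo f

lemma lintegral_uniformLaw_reflect (f : ℝ → ℝ≥0∞) :
    ∫⁻ p : UnitOpen, f (1 - p) ∂uniformLaw = ∫⁻ p : UnitOpen, f p ∂uniformLaw := by
  rw [lintegral_uniformLaw fun x => f (1 - x), lintegral_uniformLaw f,
    ← lintegral_indicator measurableSet_Ioo, ← lintegral_indicator measurableSet_Ioo,
    ← lintegral_sub_left_eq_self _ (1 : ℝ)]
  refine lintegral_congr fun x => ?_
  simp only [Set.indicator, Set.mem_Ioo, sub_sub_cancel]
  congr 1
  simp only [eq_iff_iff]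
  constructor <;> rintro ⟨h1, h2⟩ <;> constructor <;> linarith

lemma lintegral_uniformLaw_rpow {s : ℝ} (hs : -1 < s) :
    ∫⁻ p : UnitOpen, ENNReal.ofReal ((p : ℝ) ^ s) ∂uniformLaw = ENNReal.ofReal (1 / (s + 1)) := by
  rw [lintegral_uniformLaw fun x => ENNReal.ofReal (x ^ s), ← ofReal_integral_eq_lintegral_ofReal]
  · rw [← integral_Ioc_eq_integral_Ioo, ← intervalIntegral.integral_of_le zero_le_one,
      integral_rpow (Or.inl hs), Real.one_rpow, Real.zero_rpow (by linarith), sub_zero]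
  · exact (((intervalIntegrable_iff_integrableOn_Ioo_of_le zero_le_one).1
      (intervalIntegral.intervalIntegrable_rpow' hs)))
  · exact (ae_restrict_iff' measurableSet_Ioo).2 (ae_of_all _ fun x hx => Real.rpow_nonneg hx.1.le s)

lemma lintegral_expLaw (T : PosReal) (f : ℝ → ℝ≥0∞) :
    ∫⁻ x : PosReal, f x ∂(expLaw T) = ∫⁻ x in Set.Ioi (0 : ℝ), f x ∂(expMeasure (T : ℝ)⁻¹) :=
  lintegral_subtype_comap measurableSet_Ioi f

lemma exists_lintegral_expLaw_rpow_le (T : PosReal) {s : ℝ} (hs : -1 < s) :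
    ∃ C : ℝ, 0 ≤ C ∧
      ∫⁻ x : PosReal, ENNReal.ofReal ((x : ℝ) ^ s) ∂(expLaw T) ≤ ENNReal.ofReal C := by
  have hT : 0 < (T : ℝ)⁻¹ := inv_pos.2 T.2
  have hi : IntegrableOn (fun x : ℝ => (T : ℝ)⁻¹ * (x ^ s * Real.exp (-(T : ℝ)⁻¹ * x ^ (1 : ℝ))))
      (Set.Ioi 0) := (integrableOn_rpow_mul_exp_neg_mul_rpow hs one_pos hT).const_mul _
  have h0 : 0 ≤ᵐ[volume.restrict (Set.Ioi (0 : ℝ))]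
      fun x : ℝ => (T : ℝ)⁻¹ * (x ^ s * Real.exp (-(T : ℝ)⁻¹ * x ^ (1 : ℝ))) :=
    (ae_restrict_iff' measurableSet_Ioi).2 (ae_of_all _ fun x hx =>
      mul_nonneg hT.le (mul_nonneg (Real.rpow_nonneg (le_of_lt hx) s) (Real.exp_pos _).le))
  refine ⟨_, integral_nonneg_of_ae h0, ?_⟩
  have hm : Measurable (gammaPDF 1 (T : ℝ)⁻¹) := (measurable_gammaPDFReal _ _).ennreal_ofReal
  rw [lintegral_expLaw T fun x => ENNReal.ofReal (x ^ s), expMeasure, gammaMeasure,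
    setLIntegral_withDensity_eq_setLIntegral_mul _ hm (by fun_prop) measurableSet_Ioi,
    ofReal_integral_eq_lintegral_ofReal hi h0]
  refine le_of_eq (setLIntegral_congr_fun measurableSet_Ioi fun x hx => ?_)
  have hx' : (0 : ℝ) ≤ x := le_of_lt hx
  simp only [Pi.mul_apply, gammaPDF_eq, if_pos hx']
  rw [← ENNReal.ofReal_mul (by positivity)]
  congr 1
  simp
  ring

lemma lintegral_prod_fst {f : UnitOpen → ℝ≥0∞} (hf : Measurable f) (T : PosReal) :
    ∫⁻ q, f q.1 ∂(uniformLaw.prod (expLaw T)) = ∫⁻ p, f p ∂uniformLaw :=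
  measurePreserving_fst.lintegral_comp hf

lemma lintegral_prod_snd {f : PosReal → ℝ≥0∞} (hf : Measurable f) (T : PosReal) :
    ∫⁻ q, f q.2 ∂(uniformLaw.prod (expLaw T)) = ∫⁻ x, f x ∂(expLaw T) :=
  measurePreserving_snd.lintegral_comp hf

lemma uniformLaw_half_le : uniformLaw {p : UnitOpen | (1 / 2 : ℝ) ≤ p} = ENNReal.ofReal (1 / 2) := by
  have hm : MeasurableSet {p : UnitOpen | (1 / 2 : ℝ) ≤ p} :=
    measurableSet_le measurable_const measurable_subtype_coe
  rw [← lintegral_indicator_one hm]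
  have h := lintegral_uniformLaw ((Set.Ici (1 / 2 : ℝ)).indicator 1)
  have h2 : (Set.Ici (1 / 2 : ℝ)) ∩ Set.Ioo 0 1 = Set.Ico (1 / 2) 1 := by
    ext x
    simp only [Set.mem_inter_iff, Set.mem_Ici, Set.mem_Ioo, Set.mem_Ico]
    exact ⟨fun h => ⟨h.1, h.2.2⟩, fun h => ⟨h.1, by linarith [h.1], h.2⟩⟩
  rw [lintegral_indicator_one measurableSet_Ici, Measure.restrict_apply measurableSet_Ici, h2,
    Real.volume_Ico] at h
  norm_num at h ⊢
  exact h

/-! ### Sums of energies after an exchange -/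

lemma sum_update_energy (s : Finset (Fin (n + 1))) (E : Config n) (k : Fin (n + 1)) (y : PosReal) :
    ∑ l ∈ s, (Function.update E k y l : ℝ) =
      ∑ l ∈ s, (E l : ℝ) + if k ∈ s then (y : ℝ) - E k else 0 := by
  rw [← Finset.sum_ite_eq' s k fun _ => (y : ℝ) - E k, ← Finset.sum_add_distrib]
  refine Finset.sum_congr rfl fun l _ => ?_
  by_cases h : l = k
  · subst h; simp
  · simp [h]

lemma sum_mix (s : Finset (Fin (n + 1))) (i : Fin n) (E : Config n) (p : UnitOpen) :
    ∑ l ∈ s, (mix i E p l : ℝ) = ∑ l ∈ s, (E l : ℝ)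
      + (if i.castSucc ∈ s then p * ((E i.castSucc : ℝ) + E i.succ) - E i.castSucc else 0)
      + if i.succ ∈ s then (1 - p) * ((E i.castSucc : ℝ) + E i.succ) - E i.succ else 0 := by
  rw [mix, sum_update_energy, sum_update_energy,
    Function.update_of_ne (Fin.castSucc_lt_succ (i := i)).ne']

lemma sum_bathMix (s : Finset (Fin (n + 1))) (k : Fin (n + 1)) (E : Config n) (p : UnitOpen)
    (x : PosReal) : ∑ l ∈ s, (bathMix k E p x l : ℝ) = ∑ l ∈ s, (E l : ℝ)
      + if k ∈ s then p * ((E k : ℝ) + x) - E k else 0 := by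
  rw [bathMix, sum_update_energy]

lemma totalEnergy_mix (i : Fin n) (E : Config n) (p : UnitOpen) :
    totalEnergy (mix i E p) = totalEnergy E := by
  rw [totalEnergy, sum_mix, totalEnergy]
  simp
  ring

lemma totalEnergy_bathMix (k : Fin (n + 1)) (E : Config n) (p : UnitOpen) (x : PosReal) :
    totalEnergy (bathMix k E p x) = totalEnergy E - E k + p * ((E k : ℝ) + x) := by
  rw [totalEnergy, sum_bathMix, totalEnergy]
  simp
  ring

lemma measurable_totalEnergy : Measurable (totalEnergy : Config n → ℝ) := by
  unfold totalEnergy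
  fun_prop

lemma energy_le_totalEnergy (E : Config n) (k : Fin (n + 1)) : (E k : ℝ) ≤ totalEnergy E :=
  Finset.single_le_sum (f := fun l => (E l : ℝ)) (fun l _ => (E l).2.le) (Finset.mem_univ k)

lemma totalEnergy_pos (E : Config n) : 0 < totalEnergy E :=
  (E 0).2.trans_le (energy_le_totalEnergy E 0)

/-! ### Drift of the total energy -/

/-- Since `p` has mean `1/2`, the site loses half of its energy on average; what the bath adds is at
most `x`, whose mean is finite. -/
lemma exists_lintegral_totalEnergy_bathMix_le (T : PosReal) : ∃ C : ℝ, 0 ≤ C ∧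
    ∀ (k : Fin (n + 1)) (E : Config n),
      ∫⁻ q, ENNReal.ofReal (totalEnergy (bathMix k E q.1 q.2)) ∂(uniformLaw.prod (expLaw T)) ≤
        ENNReal.ofReal (totalEnergy E - E k / 2 + C) := by
  obtain ⟨C, hC0, hC⟩ := exists_lintegral_expLaw_rpow_le T (s := 1) (by norm_num)
  have hp := lintegral_uniformLaw_rpow (s := 1) (by norm_num)
  simp only [Real.rpow_one] at hC hp
  refine ⟨C, hC0, fun k E => ?_⟩
  have hW := energy_le_totalEnergy E k
  have hE := (E k).2
  have h1 : ∀ q : UnitOpen × PosReal, ENNReal.ofReal (totalEnergy (bathMix k E q.1 q.2)) ≤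
      ENNReal.ofReal (totalEnergy E - E k) + (ENNReal.ofReal q.1 * ENNReal.ofReal (E k)
        + ENNReal.ofReal q.2) := by
    intro q
    have hq0 := q.1.2.1
    have hq1 := q.1.2.2
    have hx := q.2.2
    rw [totalEnergy_bathMix, ← ENNReal.ofReal_mul hq0.le, ← ENNReal.ofReal_add (by positivity) hx.le,
      ← ENNReal.ofReal_add (by linarith) (by positivity)]
    refine ENNReal.ofReal_le_ofReal ?_
    nlinarith
  refine (lintegral_mono h1).trans ?_
  rw [lintegral_add_left measurable_const, lintegral_const, measure_univ, mul_one,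
    lintegral_add_left (by fun_prop), lintegral_mul_const _ (by fun_prop),
    lintegral_prod_fst (f := fun p => ENNReal.ofReal p) (by fun_prop),
    lintegral_prod_snd (f := fun x => ENNReal.ofReal x) (by fun_prop), hp,
    ← ENNReal.ofReal_mul (by norm_num)]
  refine (add_le_add_right (add_le_add_right hC _) _).trans ?_
  rw [← ENNReal.ofReal_add (by positivity) hC0,
    ← ENNReal.ofReal_add (by linarith) (by positivity)]
  refine ENNReal.ofReal_le_ofReal (le_of_eq ?_)
  ring

lemma rate_le (K x y : PosReal) : rate K x y ≤ K := min_le_left _ _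

/-- `x` may be negative, in which case `ENNReal.ofReal x` is `0`; the separate bound `y ≤ z` covers
that case. -/
lemma ofReal_add_ofReal_le {x y z : ℝ} (hy : 0 ≤ y) (hyz : y ≤ z) (h : x + y ≤ z) :
    ENNReal.ofReal x + ENNReal.ofReal y ≤ ENNReal.ofReal z := by
  rcases le_total 0 x with hx | hx
  · rw [← ENNReal.ofReal_add hx hy]
    exact ENNReal.ofReal_le_ofReal h
  · rw [ENNReal.ofReal_of_nonpos hx, zero_add]
    exact ENNReal.ofReal_le_ofReal hyz

/-- The mean energy lost to the left bath in one step of the jump chain. -/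
def leftLoss (TL K : PosReal) (E : Config n) : ℝ := rate K TL (E 0) * E 0 / (2 * totalCap n K)

lemma measurable_leftLoss (TL K : PosReal) : Measurable (leftLoss TL K : Config n → ℝ) := by
  unfold leftLoss
  exact ((measurable_rate K (by fun_prop) (by fun_prop)).mul (by fun_prop)).div_const _

/-- Exchanges between sites conserve `W`, so only the baths contribute. The loss to the right bath
is discarded. -/
lemma exists_jump_totalEnergy_drift (n : ℕ) (TL TR K : PosReal) : ∃ C : ℝ, ∀ E : Config n,
    ∫⁻ E', ENNReal.ofReal (totalEnergy E') ∂(jumpKernel TL TR K E)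
      + ENNReal.ofReal (leftLoss TL K E) ≤ ENNReal.ofReal (totalEnergy E) + ENNReal.ofReal C := by
  obtain ⟨CL, hCL0, hCL⟩ := exists_lintegral_totalEnergy_bathMix_le (n := n) TL
  obtain ⟨CR, hCR0, hCR⟩ := exists_lintegral_totalEnergy_bathMix_le (n := n) TR
  have hK := K.2
  have hc := totalCap_pos n K
  have hKc : (K : ℝ) ≤ totalCap n K := by
    unfold totalCap
    nlinarith [(Nat.cast_nonneg n : (0 : ℝ) ≤ n)]
  refine ⟨K * (CL + CR) / totalCap n K, fun E => ?_⟩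
  have hW := totalEnergy_pos E
  have hE0 := (E 0).2
  have hEn := (E (Fin.last n)).2
  have hW0 := energy_le_totalEnergy E 0
  have hWn := energy_le_totalEnergy E (Fin.last n)
  have hrL0 := rate_nonneg K TL (E 0)
  have hrL := rate_le K TL (E 0)
  have hrR0 := rate_nonneg K (E (Fin.last n)) TR
  have hrR := rate_le K (E (Fin.last n)) TR
  have h := lintegral_jumpKernel_le TL TR K measurable_totalEnergy E hW.le
    (A := fun _ => totalEnergy E) (BL := totalEnergy E - E 0 / 2 + CL)
    (BR := totalEnergy E - E (Fin.last n) / 2 + CR) (fun _ => hW.le) (by linarith) (by linarith)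
    (fun i => by simp [totalEnergy_mix]) (hCL 0 E) (hCR _ E)
  have hloss : leftLoss TL K E ≤ totalEnergy E := by
    rw [leftLoss, div_le_iff₀ (by positivity)]
    nlinarith [mul_le_mul (hrL.trans hKc) hW0 hE0.le hc.le]
  have hloss0 : 0 ≤ leftLoss TL K E := by
    unfold leftLoss; positivity
  refine (add_le_add_left h _).trans ?_
  rw [← ENNReal.ofReal_add hW.le (by positivity)]
  refine ofReal_add_ofReal_le hloss0 (hloss.trans (le_add_of_nonneg_right (by positivity))) ?_
  rw [leftLoss, add_assoc]
  refine add_le_add le_rfl ?_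
  rw [mul_comm (2 : ℝ), ← div_div, div_right_comm, ← add_div]
  refine div_le_div_of_nonneg_right ?_ hc.le
  simp only [sub_self, mul_zero, Finset.sum_const_zero]
  nlinarith [mul_le_mul_of_nonneg_right hrL hCL0, mul_le_mul_of_nonneg_right hrR hCR0,
    mul_nonneg hrR0 hEn.le]

lemma min_sqrt_le_rate (K : PosReal) {x y : PosReal} {ε : ℝ} (hx : ε ≤ x) (hy : ε ≤ y) :
    min (K : ℝ) (Real.sqrt ε) ≤ rate K x y :=
  min_le_min le_rfl (Real.sqrt_le_sqrt (le_min hx hy))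

lemma mix_castSucc (i : Fin n) (E : Config n) (p : UnitOpen) :
    (mix i E p i.castSucc : ℝ) = p * ((E i.castSucc : ℝ) + E i.succ) := by
  rw [mix, Function.update_of_ne (Fin.castSucc_lt_succ (i := i)).ne, Function.update_self]

lemma mix_of_ne (i : Fin n) (E : Config n) (p : UnitOpen) {l : Fin (n + 1)}
    (h1 : l ≠ i.castSucc) (h2 : l ≠ i.succ) : mix i E p l = E l := by
  rw [mix, Function.update_of_ne h2, Function.update_of_ne h1]

/-- The energy of site `k` reaches the left bath after `k` exchanges with positive probability. -/
lemma exists_le_lintegral_leftLoss (TL TR K : PosReal) {ε : ℝ} (hε : 0 < ε) (k : Fin (n + 1)) :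
    ∃ c : ℝ, 0 < c ∧ ∀ E : Config n, (∀ l ≤ k, ε ≤ E l) → ENNReal.ofReal (c * E k) ≤
      ∫⁻ E', ENNReal.ofReal (leftLoss TL K E') ∂((jumpKernel TL TR K ^ (k : ℕ)) E) := by
  have hc := totalCap_pos n K
  have hK := K.2
  have hm : Measurable fun E : Config n => ENNReal.ofReal (leftLoss TL K E) :=
    (measurable_leftLoss TL K).ennreal_ofReal
  induction k using Fin.induction with
  | zero =>
    have hT := TL.2
    refine ⟨min (K : ℝ) (Real.sqrt (min TL ε)) / (2 * totalCap n K), ?_, fun E hE => ?_⟩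
    · have : 0 < min (TL : ℝ) ε := lt_min hT hε
      have : 0 < min (K : ℝ) (Real.sqrt (min TL ε)) := lt_min hK (Real.sqrt_pos.2 this)
      positivity
    · rw [Fin.val_zero, lintegral_pow_zero _ hm]
      refine ENNReal.ofReal_le_ofReal ?_
      rw [leftLoss, div_mul_eq_mul_div]
      have := min_sqrt_le_rate K (x := TL) (y := E 0) (ε := min TL ε) (min_le_left _ _)
        ((min_le_right _ _).trans (hE 0 le_rfl))
      have := (E 0).2
      gcongr
  | succ i ih =>
    obtain ⟨c, hc0, ih⟩ := ih
    set r : ℝ := min (K : ℝ) (Real.sqrt ε) with hr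
    have hr0 : 0 < r := lt_min hK (Real.sqrt_pos.2 hε)
    -- One factor `1/2` is the probability that `p ≥ 1/2`, the other the share of the pooled energy
    -- that then moves to the left site.
    refine ⟨r / totalCap n K * (c * (1 / 2) * (1 / 2)), by positivity, fun E hE => ?_⟩
    have hpos := (E i.succ).2
    have hpos' := (E i.castSucc).2
    have hlt : i.castSucc < i.succ := Fin.castSucc_lt_succ
    have hrate : r ≤ rate K (E i.castSucc) (E i.succ) :=
      min_sqrt_le_rate K (hE _ hlt.le) (hE _ le_rfl)
    set g : Config n → ℝ≥0∞ := fun E => ∫⁻ E', ENNReal.ofReal (leftLoss TL K E')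
      ∂((jumpKernel TL TR K ^ (i.castSucc : ℕ)) E) with hg
    have hgm : Measurable g := hm.lintegral_kernel
    have hS : MeasurableSet {p : UnitOpen | (1 / 2 : ℝ) ≤ p} :=
      measurableSet_le measurable_const measurable_subtype_coe
    have key : ENNReal.ofReal (c * (1 / 2) * (1 / 2) * E i.succ) ≤
        ∫⁻ p, g (mix i E p) ∂uniformLaw := by
      calc ENNReal.ofReal (c * (1 / 2) * (1 / 2) * E i.succ)
          = ∫⁻ _ in {p : UnitOpen | (1 / 2 : ℝ) ≤ p}, ENNReal.ofReal (c * (1 / 2) * E i.succ)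
            ∂uniformLaw := by
            rw [setLIntegral_const, uniformLaw_half_le, ← ENNReal.ofReal_mul (by positivity)]
            congr 1
            ring
        _ ≤ ∫⁻ p in {p : UnitOpen | (1 / 2 : ℝ) ≤ p}, g (mix i E p) ∂uniformLaw := by
            refine setLIntegral_mono' hS fun p hp => ?_
            have hp : (1 / 2 : ℝ) ≤ p := hp
            have h1 := hE _ hlt.le
            have h2 := hE _ le_rfl
            -- The right site may become cold in this exchange, but the induction hypothesis asks
            -- for `ε` only at the sites up to the left one, whose new energy is at least `(ε + ε) /
            -- 2`.
            refine le_trans (ENNReal.ofReal_le_ofReal ?_) (ih (mix i E p) fun l hl => ?_)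
            · rw [mix_castSucc, mul_assoc]
              refine mul_le_mul_of_nonneg_left ?_ hc0.le
              nlinarith
            · rcases hl.eq_or_lt with rfl | hl'
              · rw [mix_castSucc]
                nlinarith
              · rw [mix_of_ne i E p hl'.ne (hl'.trans hlt).ne]
                exact hE l (hl'.trans hlt).le
        _ ≤ _ := setLIntegral_le_lintegral _ _
    rw [Fin.val_succ, lintegral_pow_succ' _ _ hm]
    change _ ≤ ∫⁻ y, g y ∂(jumpKernel TL TR K E)
    rw [lintegral_jumpKernel TL TR K hgm]
    -- Among all possible first jumps, only the exchange across this bond is kept.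
    refine le_trans ?_ (le_add_right (le_add_right (le_add_right (Finset.single_le_sum
      (f := fun i : Fin n => ENNReal.ofReal (rate K (E i.castSucc) (E i.succ) / totalCap n K) *
        ∫⁻ p, g (mix i E p) ∂uniformLaw) (fun _ _ => zero_le) (Finset.mem_univ i)))))
    rw [mul_assoc, ENNReal.ofReal_mul (by positivity)]
    gcongr

lemma exists_transition_totalEnergy_le (n : ℕ) (TL TR K : PosReal) {t : ℝ≥0} (ht : 0 < t) {ε : ℝ}
    (hε : 0 < ε) : ∃ (δ : ℝ) (C : ℝ≥0), 0 < δ ∧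
      (∀ E : Config n, ∫⁻ E', ENNReal.ofReal (totalEnergy E') ∂(transition TL TR K t E) ≤
        ENNReal.ofReal (totalEnergy E) + C) ∧
      ∀ E : Config n, (∀ l, ε ≤ E l) →
        ∫⁻ E', ENNReal.ofReal (totalEnergy E') ∂(transition TL TR K t E)
          + ENNReal.ofReal (δ * totalEnergy E) ≤ ENNReal.ofReal (totalEnergy E) + C := by
  obtain ⟨C, hC⟩ := exists_jump_totalEnergy_drift n TL TR K
  obtain ⟨C', hC'⟩ := exists_transition_drift TL TR K t measurable_totalEnergy.ennreal_ofReal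
    ENNReal.ofReal_ne_top hC
  choose c hc0 hc using fun k : Fin (n + 1) => exists_le_lintegral_leftLoss TL TR K hε k
  have hne : (Finset.univ : Finset (Fin (n + 1))).Nonempty := ⟨0, Finset.mem_univ 0⟩
  set c' := Finset.univ.inf' hne c with hc'
  have hc'0 : 0 < c' := (Finset.lt_inf'_iff hne).2 fun k _ => hc0 k
  have hw := poissonWeight_pos n K ht (n + 1)
  -- The event of `n + 1` jumps suffices: at most `n` bring the energy to the first site, and one
  -- more gives it to the bath.
  refine ⟨poissonWeight n K t (n + 1) * (c' / (n + 1)), C', by positivity,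
    fun E => le_self_add.trans (hC' E 0 (Nat.zero_le n)), fun E hE => ?_⟩
  obtain ⟨k, -, hk⟩ : ∃ k ∈ (Finset.univ : Finset (Fin (n + 1))),
      totalEnergy E / (n + 1) ≤ E k := by
    refine Finset.exists_le_of_sum_le hne (le_of_eq ?_)
    simp only [Finset.sum_const, Finset.card_univ, Fintype.card_fin, nsmul_eq_mul]
    push_cast
    rw [mul_div_cancel₀ _ (by positivity)]
    rfl
  refine le_trans ?_ (hC' E k (Nat.le_of_lt_succ k.2))
  refine add_le_add_right ?_ _
  rw [mul_assoc, ENNReal.ofReal_mul hw.le]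
  refine mul_le_mul_right (le_trans (ENNReal.ofReal_le_ofReal ?_) (hc k E fun l _ => hE l)) _
  rw [div_mul_eq_mul_div, mul_div_assoc]
  exact mul_le_mul (Finset.inf'_le _ (Finset.mem_univ k)) hk
    (div_nonneg (totalEnergy_pos E).le (by positivity)) (hc0 k).le

/-! ### Exponents -/

lemma coeff_succ (n k : ℕ) : coeff (n + 1) (k + 1) = 1 - (2 ^ k - 1) / (2 ^ (n + 1) - 1) := rfl

lemma two_pow_succ_sub_one_pos (n : ℕ) : (0 : ℝ) < 2 ^ (n + 1) - 1 :=
  sub_pos.2 (one_lt_pow₀ one_lt_two (Nat.succ_ne_zero n))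

lemma coeff_one (n : ℕ) : coeff (n + 1) 1 = 1 := by simp [coeff]

lemma coeff_le_one (n k : ℕ) : coeff (n + 1) (k + 1) ≤ 1 := by
  rw [coeff_succ]
  have h1 : (1 : ℝ) ≤ 2 ^ k := one_le_pow₀ one_le_two
  have := div_nonneg (sub_nonneg.2 h1) (two_pow_succ_sub_one_pos n).le
  linarith

/-- Keeps every exponent `s = a_m η - 1` at least `η / 2 - 1`, so that `p ^ s` has mean `1 / (s + 1)
≤ 2 / η`. -/
lemma half_lt_coeff {n k : ℕ} (hk : k ≤ n) : 1 / 2 < coeff (n + 1) (k + 1) := by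
  have hD := two_pow_succ_sub_one_pos n
  have h2 : (2 : ℝ) ^ k ≤ 2 ^ n := pow_le_pow_right₀ one_le_two hk
  have h3 : ((2 : ℝ) ^ k - 1) / (2 ^ (n + 1) - 1) < 1 / 2 := by
    rw [div_lt_iff₀ hD, pow_succ]
    linarith
  rw [coeff_succ]
  linarith

lemma coeff_succ_lt (n k : ℕ) : coeff (n + 1) (k + 2) < coeff (n + 1) (k + 1) := by
  rw [coeff_succ, coeff_succ]
  have h1 : (0 : ℝ) < 2 ^ k := by positivity
  refine sub_lt_sub_left (div_lt_div_of_pos_right ?_ (two_pow_succ_sub_one_pos n)) 1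
  rw [pow_succ]
  linarith

section Exponents

variable {η : ℝ}

lemma eta_lt_quarter (h1 : η < 1 / 2 ^ (n + 2)) : η < 1 / 4 := by
  refine h1.trans_le ?_
  have : (1 : ℝ) ≤ 2 ^ n := one_le_pow₀ one_le_two
  rw [pow_add]
  refine one_div_le_one_div_of_le (by norm_num) ?_
  linarith

lemma coeff_mul_lt_half (h0 : 0 < η) (h1 : η < 1 / 2 ^ (n + 2)) (k : ℕ) :
    coeff (n + 1) (k + 1) * η < 1 / 2 := by
  nlinarith [coeff_le_one n k, eta_lt_quarter h1]

/-- The choice of the coefficients `a_m` makes the gain of a block subordinate to its loss. -/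
lemma gainExponent_lt (h0 : 0 < η) (h1 : η < 1 / 2 ^ (n + 2)) {k : ℕ} (hk : k ≤ n) :
    (1 / 2 - coeff (n + 1) (k + 1) * η) / (1 - coeff (n + 1) (k + 2) * η) <
      1 - 1 / (2 * (1 - η)) := by
  have hη := eta_lt_quarter h1
  have ha' := coeff_mul_lt_half h0 h1 (k + 1)
  have hD := two_pow_succ_sub_one_pos n
  have h3 : (1 : ℝ) - 1 / (2 * (1 - η)) = (1 / 2 - η) / (1 - η) := by
    have : (1 : ℝ) - η ≠ 0 := by linarith
    field_simp
    ring
  have hq : (2 : ℝ) ^ k ≤ 2 ^ n := pow_le_pow_right₀ one_le_two hk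
  have hq0 : (0 : ℝ) < 2 ^ k := by positivity
  have hηq : η * 2 ^ k < 1 / 2 := by
    have h4 : η * 2 ^ (n + 2) < 1 := by rwa [lt_div_iff₀ (by positivity)] at h1
    rw [pow_add] at h4
    nlinarith
  rw [h3, div_lt_div_iff₀ (by linarith) (by linarith), coeff_succ, coeff_succ,
    pow_succ 2 k]
  set w : ℝ := 1 / (2 ^ (n + 1) - 1) with hw
  have hw0 : 0 < w := by positivity
  rw [div_eq_mul_one_div ((2 : ℝ) ^ k - 1), div_eq_mul_one_div ((2 : ℝ) ^ k * 2 - 1), ← hw]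
  -- With `q = 2 ^ k`, `a = a_{k+1}` and `a' = a_{k+2}`, one has `1 - 2 a + a' = -w` and `a - a' = q
  -- w`. The difference of the two cross products is thus exactly `η w (1/2 - η q)`.
  nlinarith [mul_pos (mul_pos h0 hw0) (sub_pos.2 hηq)]

/-- The strict decrease of the `a_m` makes the enlarged block control the original one with an
exponent below one; see `rpow_enlarge_le`. -/
lemma one_sub_lt_one (h0 : 0 < η) (h1 : η < 1 / 2 ^ (n + 2)) (k : ℕ) :
    (1 - coeff (n + 1) (k + 1) * η) / (1 - coeff (n + 1) (k + 2) * η) < 1 := by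
  rw [div_lt_one (by linarith [coeff_mul_lt_half h0 h1 (k + 1)])]
  nlinarith [coeff_succ_lt n k]

end Exponents

/-! ### Comparison of powers -/

lemma exists_rpow_le {β α : ℝ} (hβ : 0 ≤ β) (h : β < α) {ε : ℝ} (hε : 0 < ε) :
    ∃ C : ℝ, 0 ≤ C ∧ ∀ v : ℝ, 0 < v → v ^ β ≤ ε * v ^ α + C := by
  -- `R` is the point where `ε * v ^ (α - β) = 1`; beyond it the power `α` dominates, and below it
  -- the constant `R ^ β` suffices.
  set R : ℝ := ε ^ (-(α - β)⁻¹) with hR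
  have hR0 : 0 < R := Real.rpow_pos_of_pos hε _
  refine ⟨R ^ β, (Real.rpow_pos_of_pos hR0 _).le, fun v hv => ?_⟩
  rcases le_total v R with hvR | hvR
  · exact (Real.rpow_le_rpow hv.le hvR hβ).trans
      (le_add_of_nonneg_left (mul_nonneg hε.le (Real.rpow_nonneg hv.le _)))
  · have h1 : 1 ≤ ε * v ^ (α - β) := by
      have h2 : R ^ (α - β) ≤ v ^ (α - β) := Real.rpow_le_rpow hR0.le hvR (by linarith)
      rw [hR, ← Real.rpow_mul hε.le, neg_mul, inv_mul_cancel₀ (by linarith : α - β ≠ 0),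
        Real.rpow_neg_one] at h2
      calc (1 : ℝ) = ε * ε⁻¹ := (mul_inv_cancel₀ hε.ne').symm
        _ ≤ _ := by gcongr
    have h3 : v ^ α = v ^ (α - β) * v ^ β := by rw [← Real.rpow_add hv, sub_add_cancel]
    have h4 : 0 < v ^ β := Real.rpow_pos_of_pos hv β
    have h5 : v ^ β ≤ ε * v ^ α := by
      rw [h3, ← mul_assoc]
      exact le_mul_of_one_le_left h4.le h1
    exact h5.trans (le_add_of_nonneg_right (Real.rpow_nonneg hR0.le _))

/-- For `t ≤ 1` the factor `√t` from the rate raises the exponent to `a - 1/2`, and `hv` converts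
this power of `t` into a power of `v`. For `t ≥ 1` the power of `t` is at most `1` and `K` suffices.
-/
lemma rpow_gain_le {K r t v a a' : ℝ} (ht : 0 < t) (hr0 : 0 ≤ r) (hrK : r ≤ K)
    (hrt : r ≤ Real.sqrt t) (ha : a < 1 / 2) (ha' : a' < 1 / 2) (hv : t ^ (a' - 1) ≤ v) :
    r * t ^ (a - 1) ≤ K + v ^ ((1 / 2 - a) / (1 - a')) := by
  have hv0 : 0 < v := (Real.rpow_pos_of_pos ht _).trans_le hv
  rcases le_total 1 t with h1 | h1
  · have h2 : t ^ (a - 1) ≤ 1 := Real.rpow_le_one_of_one_le_of_nonpos h1 (by linarith)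
    have h3 : 0 < t ^ (a - 1) := Real.rpow_pos_of_pos ht _
    have h4 : 0 < v ^ ((1 / 2 - a) / (1 - a')) := Real.rpow_pos_of_pos hv0 _
    nlinarith
  · have h2 : r * t ^ (a - 1) ≤ t ^ (a - 1 / 2) := by
      refine (mul_le_mul_of_nonneg_right hrt (Real.rpow_nonneg ht.le _)).trans (le_of_eq ?_)
      rw [Real.sqrt_eq_rpow, ← Real.rpow_add ht]
      congr 1
      ring
    have h3 : t ^ (a - 1 / 2) = (t ^ (a' - 1)) ^ ((1 / 2 - a) / (1 - a')) := by
      rw [← Real.rpow_mul ht.le]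
      congr 1
      have : 1 - a' ≠ 0 := by linarith
      field_simp
      ring
    have h4 : t ^ (a - 1 / 2) ≤ v ^ ((1 / 2 - a) / (1 - a')) := by
      rw [h3]
      exact Real.rpow_le_rpow (Real.rpow_nonneg ht.le _) hv
        (div_nonneg (by linarith) (by linarith))
    linarith [hr0.trans hrK]

lemma rpow_enlarge_le {t v a a' : ℝ} (ht : 0 < t) (ha : a < 1) (ha' : a' < 1)
    (hv : t ^ (a' - 1) ≤ v) : t ^ (a - 1) ≤ v ^ ((1 - a) / (1 - a')) := by
  have h3 : t ^ (a - 1) = (t ^ (a' - 1)) ^ ((1 - a) / (1 - a')) := by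
    rw [← Real.rpow_mul ht.le]
    congr 1
    have : 1 - a' ≠ 0 := by linarith
    field_simp
    ring
  rw [h3]
  exact Real.rpow_le_rpow (Real.rpow_nonneg ht.le _) hv (div_nonneg (by linarith) (by linarith))

/-! ### Blocks -/

/-- The energy of the block of sites `i, …, j`. -/
def blockSum (i j : Fin (n + 1)) (E : Config n) : ℝ := ∑ k ∈ Finset.Icc i j, (E k : ℝ)

/-- The exponent which belongs to the block of sites `i, …, j`. -/
def blockExp (η : ℝ) (i j : Fin (n + 1)) : ℝ := coeff (n + 1) ((j : ℕ) - i + 1) * η - 1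

/-- The summand of `lowEnergy` which belongs to the block `b`. -/
def blockTerm (η : ℝ) (b : Fin (n + 1) × Fin (n + 1)) (E : Config n) : ℝ :=
  blockSum b.1 b.2 E ^ blockExp η b.1 b.2

/-- The blocks of consecutive sites. -/
def blocks (n : ℕ) : Finset (Fin (n + 1) × Fin (n + 1)) := Finset.univ.filter fun b => b.1 ≤ b.2

lemma mem_blocks {b : Fin (n + 1) × Fin (n + 1)} : b ∈ blocks n ↔ b.1 ≤ b.2 := by simp [blocks]

lemma lowEnergy_eq_sum (η : ℝ) (E : Config n) :
    lowEnergy η E = ∑ b ∈ blocks n, blockTerm η b E := by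
  rw [blocks, Finset.sum_filter, Fintype.sum_prod_type, lowEnergy]
  refine Finset.sum_congr rfl fun i _ => ?_
  rw [← Finset.sum_filter, Finset.filter_le_eq_Ici]
  rfl

lemma card_blocks_le (n : ℕ) : ((blocks n).card : ℝ) ≤ (n + 1) ^ 2 := by
  have h : (blocks n).card ≤ (n + 1) * (n + 1) := by
    refine (Finset.card_filter_le _ _).trans ?_
    simp
  calc ((blocks n).card : ℝ) ≤ ((n + 1) * (n + 1) : ℕ) := by exact_mod_cast h
    _ = _ := by push_cast; ring

lemma blocks_nonempty (n : ℕ) : (blocks n).Nonempty := ⟨(0, 0), mem_blocks.2 le_rfl⟩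

lemma energy_le_blockSum {i j k : Fin (n + 1)} (E : Config n) (hk : k ∈ Finset.Icc i j) :
    (E k : ℝ) ≤ blockSum i j E :=
  Finset.single_le_sum (f := fun l => (E l : ℝ)) (fun l _ => (E l).2.le) hk

lemma blockSum_pos {i j : Fin (n + 1)} (hij : i ≤ j) (E : Config n) : 0 < blockSum i j E :=
  (E i).2.trans_le (energy_le_blockSum E (Finset.left_mem_Icc.2 hij))

lemma blockSum_nonneg (i j : Fin (n + 1)) (E : Config n) : 0 ≤ blockSum i j E :=
  Finset.sum_nonneg fun l _ => (E l).2.le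

lemma blockTerm_nonneg (η : ℝ) (b : Fin (n + 1) × Fin (n + 1)) (E : Config n) :
    0 ≤ blockTerm η b E := Real.rpow_nonneg (blockSum_nonneg _ _ E) _

lemma measurable_blockTerm (η : ℝ) (b : Fin (n + 1) × Fin (n + 1)) :
    Measurable (blockTerm η b : Config n → ℝ) := by
  unfold blockTerm blockSum
  refine Measurable.pow_const (Finset.measurable_sum _ fun k _ => ?_) _
  fun_prop

lemma blockTerm_le_lowEnergy (η : ℝ) {b : Fin (n + 1) × Fin (n + 1)} (hb : b ∈ blocks n)
    (E : Config n) : blockTerm η b E ≤ lowEnergy η E := by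
  rw [lowEnergy_eq_sum]
  exact Finset.single_le_sum (f := fun b => blockTerm η b E)
    (fun b _ => blockTerm_nonneg η b E) hb

lemma lowEnergy_pos (η : ℝ) (E : Config n) : 0 < lowEnergy η E := by
  refine lt_of_lt_of_le ?_ (blockTerm_le_lowEnergy η (b := (0, 0)) (mem_blocks.2 le_rfl) E)
  exact Real.rpow_pos_of_pos (blockSum_pos le_rfl E) _

lemma exists_le_blockTerm (η : ℝ) (E : Config n) :
    ∃ b ∈ blocks n, lowEnergy η E / (n + 1) ^ 2 ≤ blockTerm η b E := by
  refine Finset.exists_le_of_sum_le (blocks_nonempty n) ?_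
  rw [← lowEnergy_eq_sum, Finset.sum_const, nsmul_eq_mul, mul_div_left_comm]
  refine mul_le_of_le_one_right (lowEnergy_pos η E).le ?_
  exact (div_le_one (by positivity)).2 (card_blocks_le n)

/-- Low energy at one site makes `lowEnergy` large. -/
lemma rpow_le_energy {η : ℝ} (hη : η < 1) (E : Config n) (k : Fin (n + 1)) {v : ℝ}
    (hv : lowEnergy η E ≤ v) : v ^ (-(1 / (1 - η))) ≤ E k := by
  have h1 := (blockTerm_le_lowEnergy η (b := (k, k)) (mem_blocks.2 le_rfl) E).trans hv
  have hE := (E k).2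
  have h2 : blockTerm η (k, k) E = (E k : ℝ) ^ (η - 1) := by
    simp [blockTerm, blockSum, blockExp, coeff_one]
  rw [h2] at h1
  have h3 := Real.rpow_le_rpow_of_nonpos (z := -(1 / (1 - η))) (Real.rpow_pos_of_pos hE _) h1
    (neg_nonpos.2 (one_div_nonneg.2 (by linarith)))
  rw [← Real.rpow_mul hE.le] at h3
  have h4 : (η - 1) * -(1 / (1 - η)) = 1 := by
    have : 1 - η ≠ 0 := by linarith
    field_simp
    ring
  rwa [h4, Real.rpow_one] at h3

section BlockExp

variable {η : ℝ}

lemma half_le_blockExp_add_one (h0 : 0 < η) (i j : Fin (n + 1)) : η / 2 ≤ blockExp η i j + 1 := by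
  have := half_lt_coeff (n := n) (k := (j : ℕ) - i) (by have := j.2; lia)
  unfold blockExp
  nlinarith

lemma neg_one_lt_blockExp (h0 : 0 < η) (i j : Fin (n + 1)) : -1 < blockExp η i j := by
  have := half_le_blockExp_add_one h0 i j
  linarith

lemma blockExp_neg (h0 : 0 < η) (h1 : η < 1 / 2 ^ (n + 2)) (i j : Fin (n + 1)) : blockExp η i j < 0 := by
  have := coeff_mul_lt_half h0 h1 ((j : ℕ) - i)
  unfold blockExp
  linarith

end BlockExp

/-! ### Blocks after an exchange -/

lemma blockSum_succ {a : Fin (n + 1)} {i : Fin n} (h : a ≤ i.castSucc) (E : Config n) :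
    blockSum a i.succ E = blockSum a i.castSucc E + E i.succ := by
  have : Finset.Icc a i.succ = insert i.succ (Finset.Icc a i.castSucc) := by
    ext l
    simp only [Finset.mem_Icc, Finset.mem_insert, Fin.le_def, Fin.ext_iff, Fin.val_succ,
      Fin.val_castSucc] at h ⊢
    lia
  rw [blockSum, this, Finset.sum_insert, add_comm, blockSum]
  simp [Fin.le_def]

lemma blockSum_castSucc {i : Fin n} {b : Fin (n + 1)} (h : i.succ ≤ b) (E : Config n) :
    blockSum i.castSucc b E = blockSum i.succ b E + E i.castSucc := by
  have : Finset.Icc i.castSucc b = insert i.castSucc (Finset.Icc i.succ b) := by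
    ext l
    simp only [Finset.mem_Icc, Finset.mem_insert, Fin.le_def, Fin.ext_iff, Fin.val_succ,
      Fin.val_castSucc] at h ⊢
    lia
  rw [blockSum, this, Finset.sum_insert, add_comm, blockSum]
  simp [Fin.le_def]

/-- An upper bound for the mean of a block term after the exchange between `i` and `i + 1`. -/
def mixBound (η : ℝ) (i : Fin n) (b : Fin (n + 1) × Fin (n + 1)) (E : Config n) : ℝ :=
  if b.2 = i.castSucc then
    1 / (blockExp η b.1 b.2 + 1) * blockSum b.1 i.succ E ^ blockExp η b.1 b.2
  else if b.1 = i.succ then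
    1 / (blockExp η b.1 b.2 + 1) * blockSum i.castSucc b.2 E ^ blockExp η b.1 b.2
  else blockTerm η b E

section Bounds

variable {η : ℝ}

lemma mixBound_nonneg (h0 : 0 < η) (i : Fin n) (b : Fin (n + 1) × Fin (n + 1)) (E : Config n) :
    0 ≤ mixBound η i b E := by
  have := neg_one_lt_blockExp h0 b.1 b.2
  have h : 0 ≤ 1 / (blockExp η b.1 b.2 + 1) := one_div_nonneg.2 (by linarith)
  unfold mixBound
  split_ifs
  · exact mul_nonneg h (Real.rpow_nonneg (blockSum_nonneg _ _ _) _)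
  · exact mul_nonneg h (Real.rpow_nonneg (blockSum_nonneg _ _ _) _)
  · exact blockTerm_nonneg η b E

lemma lintegral_rpow_mix_le {s : ℝ} (hs : -1 < s) (hs0 : s ≤ 0) {t : ℝ} (ht : 0 < t)
    {f : UnitOpen → ℝ} (hf : ∀ p : UnitOpen, p * t ≤ f p) :
    ∫⁻ p, ENNReal.ofReal (f p ^ s) ∂uniformLaw ≤ ENNReal.ofReal (1 / (s + 1) * t ^ s) := by
  have h : ∀ p : UnitOpen, ENNReal.ofReal (f p ^ s) ≤
      ENNReal.ofReal ((p : ℝ) ^ s) * ENNReal.ofReal (t ^ s) := fun p => by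
    have hp := p.2.1
    rw [← ENNReal.ofReal_mul (Real.rpow_nonneg hp.le _), ← Real.mul_rpow hp.le ht.le]
    exact ENNReal.ofReal_le_ofReal
      (Real.rpow_le_rpow_of_nonpos (mul_pos hp ht) (hf p) hs0)
  refine (lintegral_mono h).trans ?_
  rw [lintegral_mul_const _ (by fun_prop), lintegral_uniformLaw_rpow hs,
    ← ENNReal.ofReal_mul (one_div_nonneg.2 (by linarith))]

lemma lintegral_rpow_mix_le' {s : ℝ} (hs : -1 < s) (hs0 : s ≤ 0) {t : ℝ} (ht : 0 < t)
    {f : UnitOpen → ℝ} (hf : ∀ p : UnitOpen, (1 - p) * t ≤ f p) :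
    ∫⁻ p, ENNReal.ofReal (f p ^ s) ∂uniformLaw ≤ ENNReal.ofReal (1 / (s + 1) * t ^ s) := by
  have h : ∀ p : UnitOpen, ENNReal.ofReal (f p ^ s) ≤
      (fun x : ℝ => ENNReal.ofReal ((x * t) ^ s)) (1 - p) := fun p =>
    ENNReal.ofReal_le_ofReal (Real.rpow_le_rpow_of_nonpos
      (mul_pos (sub_pos.2 p.2.2) ht) (hf p) hs0)
  refine (lintegral_mono h).trans ?_
  rw [lintegral_uniformLaw_reflect fun x : ℝ => ENNReal.ofReal ((x * t) ^ s)]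
  exact lintegral_rpow_mix_le hs hs0 ht fun p => le_rfl

/-- If the bond crosses the right end of a block with sum `S`, the new sum is `S - E_i + p (E_i +
E_{i+1}) ≥ p (S + E_{i+1})`, because `S ≥ E_i`. The left end is symmetric with `1 - p`, and any
other bond leaves the sum unchanged. -/
lemma lintegral_blockTerm_mix_le (h0 : 0 < η) (h1 : η < 1 / 2 ^ (n + 2)) (i : Fin n)
    {b : Fin (n + 1) × Fin (n + 1)} (hb : b ∈ blocks n) (E : Config n) :
    ∫⁻ p, ENNReal.ofReal (blockTerm η b (mix i E p)) ∂uniformLaw ≤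
      ENNReal.ofReal (mixBound η i b E) := by
  have hs := neg_one_lt_blockExp h0 b.1 b.2
  have hs0 := (blockExp_neg h0 h1 b.1 b.2).le
  have hb' := mem_blocks.1 hb
  have hlt : i.castSucc < i.succ := Fin.castSucc_lt_succ
  unfold mixBound blockTerm
  split_ifs with hr hl
  · have hle : b.1 ≤ i.castSucc := hr ▸ hb'
    refine lintegral_rpow_mix_le hs hs0 (blockSum_pos (hle.trans hlt.le) E) fun p => ?_
    have hm1 : i.castSucc ∈ Finset.Icc b.1 b.2 := Finset.mem_Icc.2 ⟨hle, hr.ge⟩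
    have hm2 : i.succ ∉ Finset.Icc b.1 b.2 := fun h =>
      absurd (Finset.mem_Icc.1 h).2 (not_le.2 (hr ▸ hlt))
    have hE := energy_le_blockSum E hm1
    have hp := p.2.2
    have hsum : blockSum b.1 b.2 (mix i E p) = blockSum b.1 b.2 E
        + (p * ((E i.castSucc : ℝ) + E i.succ) - E i.castSucc) + 0 := by
      rw [blockSum, sum_mix, if_pos hm1, if_neg hm2]
      rfl
    rw [blockSum_succ hle, hsum, ← hr]
    rw [← hr] at hE
    nlinarith
  · have hle : i.succ ≤ b.2 := hl ▸ hb'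
    refine lintegral_rpow_mix_le' hs hs0 (blockSum_pos (hlt.le.trans hle) E) fun p => ?_
    have hm1 : i.succ ∈ Finset.Icc b.1 b.2 := Finset.mem_Icc.2 ⟨hl.le, hle⟩
    have hm2 : i.castSucc ∉ Finset.Icc b.1 b.2 := fun h =>
      absurd (Finset.mem_Icc.1 h).1 (not_le.2 (hl ▸ hlt))
    have hE := energy_le_blockSum E hm1
    have hp := p.2.1
    have hsum : blockSum b.1 b.2 (mix i E p) = blockSum b.1 b.2 E + 0
        + ((1 - p) * ((E i.castSucc : ℝ) + E i.succ) - E i.succ) := by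
      rw [blockSum, sum_mix, if_neg hm2, if_pos hm1]
      rfl
    rw [blockSum_castSucc hle, hsum, ← hl]
    rw [← hl] at hE
    nlinarith
  · have hiff : i.castSucc ∈ Finset.Icc b.1 b.2 ↔ i.succ ∈ Finset.Icc b.1 b.2 := by
      simp only [Finset.mem_Icc, Fin.le_def, Fin.ext_iff, Fin.val_succ,
        Fin.val_castSucc] at hr hl ⊢
      lia
    have hsum : ∀ p, blockSum b.1 b.2 (mix i E p) = blockSum b.1 b.2 E := fun p => by
      rw [blockSum, sum_mix, blockSum]
      by_cases h : i.castSucc ∈ Finset.Icc b.1 b.2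
      · rw [if_pos h, if_pos (hiff.1 h)]
        ring
      · rw [if_neg h, if_neg (mt hiff.2 h)]
        ring
    simp [hsum]

/-- A block containing the bath site has new sum at least `p x`. As its exponent exceeds `-1`, both
powers have finite mean, and the bound does not depend on `E`. -/
lemma exists_lintegral_blockTerm_bathMix_le (T : PosReal) (h0 : 0 < η)
    (h1 : η < 1 / 2 ^ (n + 2)) : ∃ C : ℝ, 0 ≤ C ∧ ∀ (b : Fin (n + 1) × Fin (n + 1)) (k : Fin (n + 1))
      (E : Config n), ∫⁻ q, ENNReal.ofReal (blockTerm η b (bathMix k E q.1 q.2))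
        ∂(uniformLaw.prod (expLaw T)) ≤
          ENNReal.ofReal (if k ∈ Finset.Icc b.1 b.2 then C else blockTerm η b E) := by
  choose c hc0 hc using fun b : Fin (n + 1) × Fin (n + 1) =>
    exists_lintegral_expLaw_rpow_le T (neg_one_lt_blockExp h0 b.1 b.2)
  have hpos : ∀ b : Fin (n + 1) × Fin (n + 1), 0 ≤ 1 / (blockExp η b.1 b.2 + 1) * c b := fun b =>
    mul_nonneg (one_div_nonneg.2 (by linarith [neg_one_lt_blockExp h0 b.1 b.2])) (hc0 b)
  refine ⟨∑ b, 1 / (blockExp η b.1 b.2 + 1) * c b, Finset.sum_nonneg fun b _ => hpos b,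
    fun b k E => ?_⟩
  have hs := neg_one_lt_blockExp h0 b.1 b.2
  have hs0 := (blockExp_neg h0 h1 b.1 b.2).le
  split_ifs with hk
  · have h : ∀ q : UnitOpen × PosReal, ENNReal.ofReal (blockTerm η b (bathMix k E q.1 q.2)) ≤
        ENNReal.ofReal ((q.1 : ℝ) ^ blockExp η b.1 b.2)
          * ENNReal.ofReal ((q.2 : ℝ) ^ blockExp η b.1 b.2) := fun q => by
      have hp := q.1.2.1
      have hx := q.2.2
      have hE := energy_le_blockSum E hk
      have hEk := (E k).2
      rw [← ENNReal.ofReal_mul (Real.rpow_nonneg hp.le _), ← Real.mul_rpow hp.le hx.le]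
      refine ENNReal.ofReal_le_ofReal
        (Real.rpow_le_rpow_of_nonpos (mul_pos hp hx) ?_ hs0)
      rw [blockSum, sum_bathMix, if_pos hk]
      change _ ≤ blockSum b.1 b.2 E + _
      nlinarith [mul_pos hp hEk]
    refine (lintegral_mono h).trans ?_
    rw [lintegral_prod_mul (f := fun p : UnitOpen => ENNReal.ofReal ((p : ℝ) ^ blockExp η b.1 b.2))
      (g := fun x : PosReal => ENNReal.ofReal ((x : ℝ) ^ blockExp η b.1 b.2))
      (by fun_prop) (by fun_prop), lintegral_uniformLaw_rpow hs]
    refine (mul_le_mul_right (hc b) _).trans ?_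
    rw [← ENNReal.ofReal_mul (one_div_nonneg.2 (by linarith))]
    exact ENNReal.ofReal_le_ofReal (Finset.single_le_sum
      (f := fun b : Fin (n + 1) × Fin (n + 1) => 1 / (blockExp η b.1 b.2 + 1) * c b)
      (fun b _ => hpos b) (Finset.mem_univ b))
  · have hsum : ∀ q : UnitOpen × PosReal, blockTerm η b (bathMix k E q.1 q.2) = blockTerm η b E :=
      fun q => by
        rw [blockTerm, blockSum, sum_bathMix, if_neg hk, add_zero]
        rfl
    simp [hsum]

/-! ### Gain and loss -/

lemma one_div_blockExp_add_one_le (h0 : 0 < η) (i j : Fin (n + 1)) :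
    1 / (blockExp η i j + 1) ≤ 2 / η := by
  rw [div_le_div_iff₀ (by linarith [neg_one_lt_blockExp h0 i j]) h0]
  linarith [half_le_blockExp_add_one h0 i j]

lemma rate_le_sqrt_left {K x y : PosReal} {t : ℝ} (h : (x : ℝ) ≤ t) : rate K x y ≤ Real.sqrt t :=
  (min_le_right _ _).trans (Real.sqrt_le_sqrt ((min_le_left _ _).trans h))

lemma rate_le_sqrt_right {K x y : PosReal} {t : ℝ} (h : (y : ℝ) ≤ t) : rate K x y ≤ Real.sqrt t :=
  (min_le_right _ _).trans (Real.sqrt_le_sqrt ((min_le_right _ _).trans h))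

/-- An exchange increases a block term by little compared to `v ^ α`, where `v = lowEnergy η E`. -/
lemma exists_mix_gain_le (n : ℕ) (K : PosReal) (h0 : 0 < η) (h1 : η < 1 / 2 ^ (n + 2)) {ε : ℝ}
    (hε : 0 < ε) : ∃ C : ℝ, 0 ≤ C ∧ ∀ (i : Fin n) (b : Fin (n + 1) × Fin (n + 1)), b ∈ blocks n →
      ∀ E : Config n, rate K (E i.castSucc) (E i.succ) * (mixBound η i b E - blockTerm η b E) ≤
        ε * lowEnergy η E ^ (1 - 1 / (2 * (1 - η))) + C := by
  set α := 1 - 1 / (2 * (1 - η)) with hα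
  have h4 := eta_lt_quarter h1
  have hβ0 : ∀ k : ℕ, 0 ≤ (1 / 2 - coeff (n + 1) (k + 1) * η) / (1 - coeff (n + 1) (k + 2) * η) :=
    fun k => div_nonneg (by linarith [coeff_mul_lt_half h0 h1 k])
      (by linarith [coeff_mul_lt_half h0 h1 (k + 1)])
  -- The factor `η / 2` offsets the bound `2 / η` for `1 / (s + 1)`.
  have hε' : 0 < ε * (η / 2) := by positivity
  choose c hc0 hc using fun k : Fin (n + 1) => exists_rpow_le (hβ0 k)
    (gainExponent_lt h0 h1 (Nat.le_of_lt_succ k.2)) hε'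
  set S := ∑ k, c k with hS
  have hS0 : 0 ≤ S := Finset.sum_nonneg fun k _ => hc0 k
  have hK := K.2
  have hcS : ∀ k, c k ≤ S := fun k =>
    Finset.single_le_sum (f := c) (fun k _ => hc0 k) (Finset.mem_univ k)
  refine ⟨2 / η * (K + S), by positivity, fun i b hb E => ?_⟩
  have hv := lowEnergy_pos η E
  have hb' := mem_blocks.1 hb
  have hr0 := rate_nonneg K (E i.castSucc) (E i.succ)
  have hlt : i.castSucc < i.succ := Fin.castSucc_lt_succ
  have hterm := blockTerm_nonneg η b E
  have hvα : 0 ≤ lowEnergy η E ^ α := Real.rpow_nonneg hv.le _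
  -- Common to both ends: `k + 1` is the length of the block and `t` the sum of the block enlarged
  -- by one site across the bond.
  have key : ∀ (t : ℝ) (k : ℕ) (_ : k ≤ n), 0 < t → rate K (E i.castSucc) (E i.succ) ≤ Real.sqrt t →
      blockExp η b.1 b.2 = coeff (n + 1) (k + 1) * η - 1 →
      t ^ (coeff (n + 1) (k + 2) * η - 1) ≤ lowEnergy η E →
      rate K (E i.castSucc) (E i.succ) * (1 / (blockExp η b.1 b.2 + 1) * t ^ blockExp η b.1 b.2
        - blockTerm η b E) ≤ ε * lowEnergy η E ^ α + 2 / η * (K + S) := by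
    intro t k hk ht hrt hexp htv
    have hg := rpow_gain_le ht hr0 (rate_le K _ _) hrt (coeff_mul_lt_half h0 h1 k)
      (coeff_mul_lt_half h0 h1 (k + 1)) htv
    have hg2 := hc ⟨k, Nat.lt_succ_of_le hk⟩ _ hv
    have hg3 := hcS ⟨k, Nat.lt_succ_of_le hk⟩
    rw [← hexp] at hg
    have hone := one_div_blockExp_add_one_le h0 b.1 b.2
    have hts : 0 ≤ t ^ blockExp η b.1 b.2 := Real.rpow_nonneg ht.le _
    calc _ ≤ rate K (E i.castSucc) (E i.succ) * (1 / (blockExp η b.1 b.2 + 1)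
          * t ^ blockExp η b.1 b.2) := mul_le_mul_of_nonneg_left (by linarith) hr0
      _ = 1 / (blockExp η b.1 b.2 + 1) * (rate K (E i.castSucc) (E i.succ)
          * t ^ blockExp η b.1 b.2) := by ring
      _ ≤ 2 / η * (K + (ε * (η / 2) * lowEnergy η E ^ α + S)) := by
          refine mul_le_mul hone (by linarith) (mul_nonneg hr0 hts) (by positivity)
      _ = _ := by
          field_simp
          ring
  unfold mixBound
  split_ifs with hr hl
  · have hle : b.1 ≤ i.castSucc := hr ▸ hb'
    have hle' := hle.trans hlt.le
    have hbm : (b.1, i.succ) ∈ blocks n := mem_blocks.2 hle'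
    refine key _ ((i.castSucc : ℕ) - b.1) (by have := i.castSucc.2; lia) (blockSum_pos hle' E)
      (rate_le_sqrt_right (energy_le_blockSum E (Finset.right_mem_Icc.2 hle'))) ?_ ?_
    · rw [hr]
      rfl
    · refine le_trans (le_of_eq ?_) (blockTerm_le_lowEnergy η hbm E)
      rw [blockTerm, blockExp]
      have : (i.succ : ℕ) - b.1 + 1 = (i.castSucc : ℕ) - b.1 + 2 := by
        rw [Fin.le_def] at hle
        simp only [Fin.val_succ, Fin.val_castSucc] at hle ⊢
        lia
      rw [this]
  · have hle : i.succ ≤ b.2 := hl ▸ hb'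
    have hle' := hlt.le.trans hle
    have hbm : (i.castSucc, b.2) ∈ blocks n := mem_blocks.2 hle'
    refine key _ ((b.2 : ℕ) - i.succ) (by have := b.2.2; lia) (blockSum_pos hle' E)
      (rate_le_sqrt_left (energy_le_blockSum E (Finset.left_mem_Icc.2 hle'))) ?_ ?_
    · rw [hl]
      rfl
    · refine le_trans (le_of_eq ?_) (blockTerm_le_lowEnergy η hbm E)
      rw [blockTerm, blockExp]
      have : (b.2 : ℕ) - i.castSucc + 1 = (b.2 : ℕ) - i.succ + 2 := by
        rw [Fin.le_def] at hle
        simp only [Fin.val_succ, Fin.val_castSucc] at hle ⊢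
        lia
      rw [this]
  · rw [sub_self, mul_zero]
    positivity

end Bounds

section Loss

variable {η : ℝ}

/-- `v ^ α` is the lower bound `v ^ (-1 / (2 (1 - η)))` for the rate times `v`. Of the term `φ ≥ v /
N`, at least half is lost. -/
lemma mul_sub_le_neg_rpow (hη : η < 1) {v r A φ N : ℝ} (hv : 0 < v) (hN : 0 < N)
    (hr : Real.sqrt (v ^ (-(1 / (1 - η)))) ≤ r) (hA : A ≤ v / (2 * N)) (hφ : v / N ≤ φ) :
    r * (A - φ) ≤ -(v ^ (1 - 1 / (2 * (1 - η))) / (2 * N)) := by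
  have hρ : v ^ (1 - 1 / (2 * (1 - η))) = Real.sqrt (v ^ (-(1 / (1 - η)))) * v := by
    rw [Real.sqrt_eq_rpow, ← Real.rpow_mul hv.le]
    nth_rewrite 3 [← Real.rpow_one v]
    rw [← Real.rpow_add hv]
    congr 1
    have : 1 - η ≠ 0 := by linarith
    field_simp
    ring
  have h1 : A - φ ≤ -(v / (2 * N)) := by
    have h2 : v / N = v / (2 * N) + v / (2 * N) := by field_simp; norm_num
    linarith
  have h2 : 0 ≤ v / (2 * N) := by positivity
  have h3 : 0 ≤ Real.sqrt (v ^ (-(1 / (1 - η)))) := Real.sqrt_nonneg _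
  rw [hρ, mul_div_assoc]
  nlinarith [mul_le_mul_of_nonneg_right hr h2]

/-- When `lowEnergy` is large, an exchange at the right end of a dominant block decreases the term
of this block. -/
lemma exists_loss_le (n : ℕ) (TR K : PosReal) (h0 : 0 < η) (h1 : η < 1 / 2 ^ (n + 2)) (C : ℝ) :
    ∃ M : ℝ, ∀ (E : Config n) (b : Fin (n + 1) × Fin (n + 1)), b ∈ blocks n → M ≤ lowEnergy η E →
      lowEnergy η E / (n + 1) ^ 2 ≤ blockTerm η b E →
      (∀ i : Fin n, b.2 = i.castSucc →
        rate K (E i.castSucc) (E i.succ) * (mixBound η i b E - blockTerm η b E) ≤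
          -(lowEnergy η E ^ (1 - 1 / (2 * (1 - η))) / (2 * (n + 1) ^ 2))) ∧
      rate K (E (Fin.last n)) TR * (C - blockTerm η b E) ≤
          -(lowEnergy η E ^ (1 - 1 / (2 * (1 - η))) / (2 * (n + 1) ^ 2)) := by
  have h4 := eta_lt_quarter h1
  have hN : (0 : ℝ) < (n + 1) ^ 2 := by positivity
  have hK := K.2
  -- For large `v`, the mean term after the exchange, of order `v ^ γ` with `γ < 1`, is below half
  -- of the dominant term. The level `M` is also chosen so that `v ^ (-1 / (1 - η))` lies below `TR`
  -- and `K ^ 2`; then neither the bath temperature nor the cap limits the lower bound for the rate.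
  have e1 : ∀ k : Fin (n + 1), ∀ᶠ v : ℝ in Filter.atTop,
      2 / η * v ^ ((1 - coeff (n + 1) (k + 1) * η) / (1 - coeff (n + 1) (k + 2) * η)) ≤
        v / (2 * (n + 1) ^ 2) := by
    intro k
    have hγ := one_sub_lt_one h0 h1 (k : ℕ)
    set γ := (1 - coeff (n + 1) (k + 1) * η) / (1 - coeff (n + 1) (k + 2) * η)
    have ht := tendsto_rpow_neg_atTop (sub_pos.2 hγ)
    have hpos : 0 < η / (4 * ((n : ℝ) + 1) ^ 2) := by positivity
    filter_upwards [ht.eventually_le_const hpos, Filter.eventually_gt_atTop 0] with v hv hv0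
    have h5 : v ^ γ = v ^ (-(1 - γ)) * v := by
      nth_rewrite 3 [← Real.rpow_one v]
      rw [← Real.rpow_add hv0]
      congr 1
      ring
    rw [h5]
    calc 2 / η * (v ^ (-(1 - γ)) * v) ≤ 2 / η * (η / (4 * ((n : ℝ) + 1) ^ 2) * v) := by gcongr
      _ = v / (2 * (n + 1) ^ 2) := by
        field_simp
        norm_num
  have ht := tendsto_rpow_neg_atTop (y := 1 / (1 - η)) (one_div_pos.2 (by linarith))
  have e4 : ∀ᶠ v : ℝ in Filter.atTop, C ≤ v / (2 * (n + 1) ^ 2) := by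
    filter_upwards [Filter.eventually_ge_atTop (C * (2 * ((n : ℝ) + 1) ^ 2))] with v hv
    rwa [le_div_iff₀ (by positivity)]
  obtain ⟨M, hM⟩ := Filter.eventually_atTop.1 ((Filter.eventually_all.2 e1).and
    ((ht.eventually_le_const TR.2).and ((ht.eventually_le_const (sq_pos_of_pos hK)).and e4)))
  refine ⟨M, fun E b hb hv hφ => ?_⟩
  obtain ⟨hv1, hv2, hv3, hv4⟩ := hM _ hv
  have hv0 := lowEnergy_pos η E
  have hsite : ∀ k, lowEnergy η E ^ (-(1 / (1 - η))) ≤ E k := fun k =>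
    rpow_le_energy (by linarith) E k le_rfl
  have hKρ : min (K : ℝ) (Real.sqrt (lowEnergy η E ^ (-(1 / (1 - η))))) =
      Real.sqrt (lowEnergy η E ^ (-(1 / (1 - η)))) :=
    min_eq_right ((Real.sqrt_le_left hK.le).2 hv3)
  refine ⟨fun i hr => ?_, ?_⟩
  · have hb' := mem_blocks.1 hb
    have hlt : i.castSucc < i.succ := Fin.castSucc_lt_succ
    have hle : b.1 ≤ i.castSucc := hr ▸ hb'
    have hle' := hle.trans hlt.le
    refine mul_sub_le_neg_rpow (by linarith) hv0 hN (hKρ ▸ min_sqrt_le_rate K (hsite _) (hsite _))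
      ?_ hφ
    rw [mixBound, if_pos hr]
    have hk : (i.castSucc : ℕ) - b.1 < n + 1 := by have := i.castSucc.2; lia
    refine le_trans ?_ (hv1 ⟨(i.castSucc : ℕ) - b.1, hk⟩)
    have hone := one_div_blockExp_add_one_le h0 b.1 b.2
    have ht := blockSum_pos hle' E
    refine mul_le_mul hone ?_ (Real.rpow_nonneg ht.le _) (by positivity)
    have hexp : blockExp η b.1 b.2 = coeff (n + 1) ((i.castSucc : ℕ) - b.1 + 1) * η - 1 := by
      rw [hr]
      rfl
    rw [hexp]
    refine rpow_enlarge_le ht (by linarith [coeff_mul_lt_half h0 h1 ((i.castSucc : ℕ) - b.1)])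
      (by linarith [coeff_mul_lt_half h0 h1 ((i.castSucc : ℕ) - b.1 + 1)]) ?_
    refine le_trans (le_of_eq ?_)
      (blockTerm_le_lowEnergy η (b := (b.1, i.succ)) (mem_blocks.2 hle') E)
    rw [blockTerm, blockExp]
    have : (i.succ : ℕ) - b.1 + 1 = (i.castSucc : ℕ) - b.1 + 2 := by
      rw [Fin.le_def] at hle
      simp only [Fin.val_succ, Fin.val_castSucc] at hle ⊢
      lia
    rw [this]
  · exact mul_sub_le_neg_rpow (by linarith) hv0 hN
      (hKρ ▸ min_sqrt_le_rate K (hsite _) hv2) hv4 hφ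

end Loss

/-! ### Balance of gain and loss: the drift of `V`. -/

lemma sum_le_card_mul_add {ι : Type*} {s : Finset ι} {x : ι → ℝ} {G L : ℝ} (hG : 0 ≤ G)
    (hx : ∀ i ∈ s, x i ≤ G) {j : ι} (hj : j ∈ s) (hL : x j ≤ L) : ∑ i ∈ s, x i ≤ s.card * G + L := by
  classical
  rw [← Finset.sum_erase_add _ _ hj]
  have h := Finset.sum_le_card_nsmul (s.erase j) x G fun i hi => hx i (Finset.mem_of_mem_erase hi)
  rw [nsmul_eq_mul] at h
  have h2 : ((s.erase j).card : ℝ) ≤ s.card := by exact_mod_cast Finset.card_erase_le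
  nlinarith

lemma lintegral_lowEnergy_comp {X : Type*} [MeasurableSpace X] (η : ℝ) (μ : Measure X)
    {f : X → Config n} (hf : Measurable f) : ∫⁻ a, ENNReal.ofReal (lowEnergy η (f a)) ∂μ =
      ∑ b ∈ blocks n, ∫⁻ a, ENNReal.ofReal (blockTerm η b (f a)) ∂μ := by
  have hm : ∀ b ∈ blocks n, Measurable fun a => ENNReal.ofReal (blockTerm η b (f a)) := fun b _ =>
    ((measurable_blockTerm η b).comp hf).ennreal_ofReal
  rw [← lintegral_finsetSum _ hm]
  refine lintegral_congr fun a => ?_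
  rw [lowEnergy_eq_sum, ENNReal.ofReal_sum_of_nonneg fun b _ => blockTerm_nonneg η b _]

/-- The drift of `lowEnergy` under the jump chain. -/
lemma exists_jump_lowEnergy_drift (n : ℕ) (TL TR K : PosReal) {η : ℝ} (h0 : 0 < η)
    (h1 : η < 1 / 2 ^ (n + 2)) : ∃ (c C : ℝ), 0 < c ∧ ∀ E : Config n,
      ∫⁻ E', ENNReal.ofReal (lowEnergy η E') ∂(jumpKernel TL TR K E)
        + ENNReal.ofReal (c * lowEnergy η E ^ (1 - 1 / (2 * (1 - η)))) ≤
          ENNReal.ofReal (lowEnergy η E) + ENNReal.ofReal C := by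
  set α := 1 - 1 / (2 * (1 - η)) with hα
  have h4 := eta_lt_quarter h1
  have hα0 : 0 ≤ α := by
    rw [hα, sub_nonneg, div_le_one (by linarith)]
    linarith
  have hα1 : α ≤ 1 := by
    rw [hα, sub_le_self_iff]
    exact one_div_nonneg.2 (by linarith)
  have hc := totalCap_pos n K
  have hK := K.2
  obtain ⟨CL, hCL0, hCL⟩ := exists_lintegral_blockTerm_bathMix_le (n := n) TL h0 h1
  obtain ⟨CR, hCR0, hCR⟩ := exists_lintegral_blockTerm_bathMix_le (n := n) TR h0 h1
  set κ : ℝ := 1 / (2 * (n + 1) ^ 2) with hκ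
  have hκ0 : 0 < κ := by positivity
  -- `Q` counts the gains: at most `N ^ 2` blocks with `N + 1` events each, and `N + 1` further ones
  -- because the dominant block is counted twice. With `ε = κ / (2 Q)` all gains together use up
  -- only half of the loss `κ V ^ α`.
  set Q : ℝ := ((n + 1) ^ 2 + 1) * (n + 2) with hQ
  have hQ0 : 0 < Q := by positivity
  obtain ⟨C, hC0, hgain⟩ := exists_mix_gain_le n K h0 h1 (ε := κ / (2 * Q)) (by positivity)
  obtain ⟨M, hloss⟩ := exists_loss_le n TR K h0 h1 CR
  set C₁ : ℝ := C + K * (CL + CR) with hC₁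
  have hC₁0 : 0 ≤ C₁ := by positivity
  -- Makes the bound `L` valid for `V ≤ M` as well, where `V ^ α ≤ |M| ^ α` and no loss is claimed.
  set C₂ : ℝ := (κ / (2 * Q) + κ) * |M| ^ α + C₁ with hC₂
  have hC₂0 : 0 ≤ C₂ := by
    have : 0 ≤ |M| ^ α := Real.rpow_nonneg (abs_nonneg M) α
    positivity
  -- The minimum with `1` and the summand `+ 1` ensure that the loss is at most `V` plus the
  -- constant, as `ofReal_add_ofReal_le` requires.
  refine ⟨min (κ / 2 / totalCap n K) 1, (Q * C₁ + C₂) / totalCap n K + 1,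
    lt_min (by positivity) one_pos, fun E => ?_⟩
  set v := lowEnergy η E with hv
  have hv0 : 0 < v := lowEnergy_pos η E
  have hvα : 0 ≤ v ^ α := Real.rpow_nonneg hv0.le α
  set bL : Fin (n + 1) × Fin (n + 1) → ℝ :=
    fun b => if 0 ∈ Finset.Icc b.1 b.2 then CL else blockTerm η b E with hbL
  set bR : Fin (n + 1) × Fin (n + 1) → ℝ :=
    fun b => if Fin.last n ∈ Finset.Icc b.1 b.2 then CR else blockTerm η b E with hbR
  have hbL0 : ∀ b, 0 ≤ bL b := fun b => by
    simp only [hbL]; split_ifs; exacts [hCL0, blockTerm_nonneg η b E]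
  have hbR0 : ∀ b, 0 ≤ bR b := fun b => by
    simp only [hbR]; split_ifs; exacts [hCR0, blockTerm_nonneg η b E]
  set G : ℝ := κ / (2 * Q) * v ^ α + C₁ with hG
  have hG0 : 0 ≤ G := by positivity
  -- every block and every bond
  have gi : ∀ b ∈ blocks n, ∀ i : Fin n,
      rate K (E i.castSucc) (E i.succ) * (mixBound η i b E - blockTerm η b E) ≤ G :=
    fun b hb i => (hgain i b hb E).trans (by
      rw [hG, hC₁]; linarith [mul_nonneg hK.le (add_nonneg hCL0 hCR0)])
  have hbath : ∀ (x y : PosReal) (b : Fin (n + 1) × Fin (n + 1)) (k : Fin (n + 1)) (D : ℝ), 0 ≤ D →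
      D ≤ CL + CR → rate K x y * ((if k ∈ Finset.Icc b.1 b.2 then D else blockTerm η b E)
        - blockTerm η b E) ≤ G := by
    intro x y b k D hD0 hD
    have hr0 := rate_nonneg K x y
    have hr := rate_le K x y
    split_ifs
    · have hφ := blockTerm_nonneg η b E
      have : 0 ≤ κ / (2 * Q) * v ^ α := by positivity
      calc rate K x y * (D - blockTerm η b E) ≤ rate K x y * D :=
            mul_le_mul_of_nonneg_left (by linarith) hr0
        _ ≤ K * (CL + CR) := mul_le_mul hr hD hD0 hK.le
        _ ≤ G := by rw [hG, hC₁]; linarith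
    · rw [sub_self, mul_zero]
      exact hG0
  have gL : ∀ b, rate K TL (E 0) * (bL b - blockTerm η b E) ≤ G := fun b =>
    hbath _ _ b 0 CL hCL0 (by linarith)
  have gR : ∀ b, rate K (E (Fin.last n)) TR * (bR b - blockTerm η b E) ≤ G := fun b =>
    hbath _ _ b (Fin.last n) CR hCR0 (by linarith)
  -- the dominant block
  obtain ⟨b₀, hb₀, hφ⟩ := exists_le_blockTerm η E
  set L : ℝ := -(κ * v ^ α) + C₂ with hL
  have hsmall : v ≤ M → G ≤ L := fun hvM => by
    have : v ^ α ≤ |M| ^ α := Real.rpow_le_rpow hv0.le (hvM.trans (le_abs_self M)) hα0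
    have := mul_le_mul_of_nonneg_left this (by positivity : 0 ≤ κ / (2 * Q) + κ)
    rw [hG, hL, hC₂]
    linarith
  have hbig : -(v ^ α / (2 * (n + 1) ^ 2)) ≤ L := by
    rw [hL, hκ, div_mul_eq_mul_div, one_mul]
    linarith
  set x : Fin (n + 1) × Fin (n + 1) → ℝ := fun b =>
    (∑ i : Fin n, rate K (E i.castSucc) (E i.succ) * (mixBound η i b E - blockTerm η b E))
      + rate K TL (E 0) * (bL b - blockTerm η b E)
      + rate K (E (Fin.last n)) TR * (bR b - blockTerm η b E) with hx
  have hxb : ∀ b ∈ blocks n, x b ≤ (n + 2) * G := fun b hb => by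
    have h := Finset.sum_le_card_nsmul Finset.univ _ G fun i _ => gi b hb i
    rw [Finset.card_univ, Fintype.card_fin, nsmul_eq_mul] at h
    have := gL b
    have := gR b
    simp only [hx]
    linarith
  have hx₀ : x b₀ ≤ (n + 2) * G + L := by
    simp only [hx]
    have hL' := gL b₀
    have hR' := gR b₀
    -- The right neighbour of the dominant block is a site or the right bath; the exchange with it
    -- supplies the loss.
    rcases Fin.eq_castSucc_or_eq_last b₀.2 with ⟨i, hi⟩ | hlast
    · have hLi : rate K (E i.castSucc) (E i.succ) * (mixBound η i b₀ E - blockTerm η b₀ E) ≤ L := by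
        rcases le_total v M with hvM | hvM
        · exact (gi b₀ hb₀ i).trans (hsmall hvM)
        · exact ((hloss E b₀ hb₀ hvM hφ).1 i hi).trans hbig
      have h := sum_le_card_mul_add (s := Finset.univ) hG0 (fun i _ => gi b₀ hb₀ i)
        (Finset.mem_univ i) hLi
      rw [Finset.card_univ, Fintype.card_fin] at h
      linarith
    · have hLR : rate K (E (Fin.last n)) TR * (bR b₀ - blockTerm η b₀ E) ≤ L := by
        rcases le_total v M with hvM | hvM
        · exact hR'.trans (hsmall hvM)
        · have : bR b₀ = CR := if_pos (Finset.mem_Icc.2 ⟨Fin.le_last _, hlast.ge⟩)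
          rw [this]
          exact (hloss E b₀ hb₀ hvM hφ).2.trans hbig
      have h := Finset.sum_le_card_nsmul Finset.univ _ G fun i _ => gi b₀ hb₀ i
      rw [Finset.card_univ, Fintype.card_fin, nsmul_eq_mul] at h
      linarith
  have hsum : ∑ b ∈ blocks n, x b ≤ -(κ / 2 * v ^ α) + (Q * C₁ + C₂) := by
    have h := sum_le_card_mul_add (by positivity) hxb hb₀ hx₀
    have h2 := mul_le_mul_of_nonneg_right (card_blocks_le n) (by positivity : 0 ≤ (n + 2) * G)
    have h3 : Q * G = κ / 2 * v ^ α + Q * C₁ := by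
      rw [hG]
      field_simp
    have h5 : ((n : ℝ) + 1) ^ 2 * ((n + 2) * G) + (n + 2) * G = Q * G := by rw [hQ]; ring
    linarith
  -- the generator
  have hmain := lintegral_jumpKernel_le TL TR K (measurable_lowEnergy η) E hv0.le
    (A := fun i => ∑ b ∈ blocks n, mixBound η i b E) (BL := ∑ b ∈ blocks n, bL b)
    (BR := ∑ b ∈ blocks n, bR b)
    (fun i => Finset.sum_nonneg fun b _ => mixBound_nonneg h0 i b E)
    (Finset.sum_nonneg fun b _ => hbL0 b) (Finset.sum_nonneg fun b _ => hbR0 b)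
    (fun i => by
      rw [lintegral_lowEnergy_comp η _ (f := fun p => mix i E p)
          ((measurable_mix i).comp measurable_prodMk_left),
        ENNReal.ofReal_sum_of_nonneg fun b _ => mixBound_nonneg h0 i b E]
      exact Finset.sum_le_sum fun b hb => lintegral_blockTerm_mix_le h0 h1 i hb E)
    (by
      rw [lintegral_lowEnergy_comp η _ (f := fun q : UnitOpen × PosReal => bathMix 0 E q.1 q.2)
          ((measurable_bathMix 0).comp measurable_prodMk_left),
        ENNReal.ofReal_sum_of_nonneg fun b _ => hbL0 b]
      exact Finset.sum_le_sum fun b hb => hCL b 0 E)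
    (by
      rw [lintegral_lowEnergy_comp η _ (f := fun q : UnitOpen × PosReal => bathMix (Fin.last n) E q.1 q.2)
          ((measurable_bathMix _).comp measurable_prodMk_left),
        ENNReal.ofReal_sum_of_nonneg fun b _ => hbR0 b]
      exact Finset.sum_le_sum fun b hb => hCR b _ E)
  have hD : (∑ i : Fin n, rate K (E i.castSucc) (E i.succ)
        * (∑ b ∈ blocks n, mixBound η i b E - lowEnergy η E))
      + rate K TL (E 0) * (∑ b ∈ blocks n, bL b - lowEnergy η E)
      + rate K (E (Fin.last n)) TR * (∑ b ∈ blocks n, bR b - lowEnergy η E) =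
        ∑ b ∈ blocks n, x b := by
    simp only [hx, lowEnergy_eq_sum, ← Finset.sum_sub_distrib, Finset.mul_sum,
      Finset.sum_add_distrib]
    rw [Finset.sum_comm]
  rw [hD] at hmain
  refine (add_le_add_left hmain _).trans ?_
  have hCC : 0 ≤ (Q * C₁ + C₂) / totalCap n K := by positivity
  rw [← ENNReal.ofReal_add hv0.le (by positivity)]
  have hmin0 : 0 ≤ min (κ / 2 / totalCap n K) 1 := le_min (by positivity) zero_le_one
  refine ofReal_add_ofReal_le (mul_nonneg hmin0 hvα) ?_ ?_
  · have h5 : v ^ α ≤ v + 1 := by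
      rcases le_total 1 v with h | h
      · exact (Real.rpow_le_rpow_of_exponent_le h hα1).trans (by rw [Real.rpow_one]; linarith)
      · exact (Real.rpow_le_one hv0.le h hα0).trans (by linarith)
    have h6 : min (κ / 2 / totalCap n K) 1 * v ^ α ≤ v ^ α :=
      mul_le_of_le_one_left hvα (min_le_right _ _)
    linarith
  · have h5 : min (κ / 2 / totalCap n K) 1 * v ^ α ≤ κ / 2 / totalCap n K * v ^ α :=
      mul_le_mul_of_nonneg_right (min_le_left _ _) hvα
    have h6 := div_le_div_of_nonneg_right hsum hc.le
    have h7 : (-(κ / 2 * v ^ α) + (Q * C₁ + C₂)) / totalCap n K =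
        -(κ / 2 / totalCap n K * v ^ α) + (Q * C₁ + C₂) / totalCap n K := by ring
    rw [h7] at h6
    linarith

lemma exists_transition_lowEnergy_drift (n : ℕ) (TL TR K : PosReal) {η : ℝ} (h0 : 0 < η)
    (h1 : η < 1 / 2 ^ (n + 2)) {t : ℝ≥0} (ht : 0 < t) :
    ∃ (c : ℝ) (C : ℝ≥0), 0 < c ∧ ∀ E : Config n,
      ∫⁻ E', ENNReal.ofReal (lowEnergy η E') ∂(transition TL TR K t E)
        + ENNReal.ofReal (c * lowEnergy η E ^ (1 - 1 / (2 * (1 - η)))) ≤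
          ENNReal.ofReal (lowEnergy η E) + C := by
  obtain ⟨c, C, hc0, hC⟩ := exists_jump_lowEnergy_drift n TL TR K h0 h1
  obtain ⟨C', hC'⟩ := exists_transition_drift TL TR K t (measurable_lowEnergy η).ennreal_ofReal
    ENNReal.ofReal_ne_top hC
  have hw := poissonWeight_pos n K ht (n + 1)
  refine ⟨poissonWeight n K t (n + 1) * c, C', mul_pos hw hc0, fun E => ?_⟩
  -- With `k = 0` the loss is evaluated at the starting configuration itself.
  have h := hC' E 0 (Nat.zero_le n)
  rwa [lintegral_pow_zero _ (by
    exact (((measurable_lowEnergy η).pow_const _).const_mul c).ennreal_ofReal),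
    ← ENNReal.ofReal_mul hw.le, ← mul_assoc] at h

/-! ### Admissible levels and the drift off `G`. -/

lemma lintegral_le_ofReal_sub {X : Type*} [MeasurableSpace X] {μ : Measure X} {f : X → ℝ≥0∞}
    {v c C : ℝ} (hc : 0 ≤ c) (hC : C ≤ c)
    (h : ∫⁻ x, f x ∂μ + ENNReal.ofReal (c + c) ≤ ENNReal.ofReal v + ENNReal.ofReal C) :
    ∫⁻ x, f x ∂μ ≤ ENNReal.ofReal (v - c) := by
  rw [ENNReal.ofReal_sub _ hc]
  refine ENNReal.le_sub_of_add_le_right ENNReal.ofReal_ne_top ?_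
  rw [ENNReal.ofReal_add hc hc, ← add_assoc] at h
  exact (ENNReal.add_le_add_iff_right ENNReal.ofReal_ne_top).1
    (h.trans (add_le_add_right (ENNReal.ofReal_le_ofReal hC) _))

/-- Since `α > 0`, half of the loss `c V ^ α` exceeds the constant `C` once `V` is large; the other
half is the required drift. -/
lemma exists_isDriftLevel (n : ℕ) (TL TR K : PosReal) {η : ℝ} (h0 : 0 < η)
    (h1 : η < 1 / 2 ^ (n + 2)) {t : ℝ≥0} (ht : 0 < t) : ∃ M₀, IsDriftLevel n TL TR K η t M₀ := by
  obtain ⟨c, C, hc0, hC⟩ := exists_transition_lowEnergy_drift n TL TR K h0 h1 ht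
  have h4 := eta_lt_quarter h1
  have hα0 : 0 < 1 - 1 / (2 * (1 - η)) := by
    rw [sub_pos, div_lt_one (by linarith)]
    linarith
  obtain ⟨M, hM⟩ := Filter.eventually_atTop.1
    ((tendsto_rpow_atTop hα0).eventually_ge_atTop ((C : ℝ) / (c / 2)))
  refine ⟨max M 2, lt_max_of_lt_right one_lt_two, c / 2, by positivity, fun E hE => ?_⟩
  have hv := lowEnergy_pos η E
  have hge := hM _ ((le_max_left _ _).trans hE.le)
  rw [div_le_iff₀ (by positivity), mul_comm] at hge
  have hvα := Real.rpow_nonneg hv.le (1 - 1 / (2 * (1 - η)))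
  refine lintegral_le_ofReal_sub (by positivity) hge ?_
  rw [← add_mul, add_halves]
  exact (hC E).trans (by rw [ENNReal.ofReal_coe_nnreal])

lemma IsDriftLevel.exists_add_le {TL TR K : PosReal} {η M₀ : ℝ} {t : ℝ≥0}
    (hα : 0 ≤ 1 - 1 / (2 * (1 - η))) (h : IsDriftLevel n TL TR K η t M₀) :
    ∃ c : ℝ, 0 < c ∧ ∀ E ∉ activeSet n η M₀,
      ∫⁻ E', ENNReal.ofReal (lowEnergy η E') ∂(transition TL TR K t E) + ENNReal.ofReal c ≤
        ENNReal.ofReal (lowEnergy η E) := by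
  obtain ⟨hM, c, hc, h⟩ := h
  -- Off `G`, `V > M₀ > 1` gives `V ^ α ≥ 1`, so the loss is at least a constant; capping it at `1`
  -- keeps it below `V`.
  refine ⟨min c 1, lt_min hc one_pos, fun E hE => ?_⟩
  have hE' : M₀ < lowEnergy η E := not_le.1 hE
  have hv : 1 ≤ lowEnergy η E := (hM.trans hE').le
  refine (add_le_add_left (h E hE') _).trans (ofReal_add_ofReal_le (le_min hc.le zero_le_one)
    ((min_le_right _ _).trans hv) ?_)
  have h1 := Real.one_le_rpow hv hα
  have h2 := min_le_left c 1
  nlinarith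

end EnergyExchange

end

/-! ### Contraction of `W` under the induced chain. -/

open EnergyExchange in
theorem mainTheorem6 (n : ℕ) (TL TR K : PosReal) :
    ∃ η₀ : ℝ, 0 < η₀ ∧ ∃ h₀ : ℝ≥0, 0 < h₀ ∧
      ∀ η : ℝ, 0 < η → η < η₀ → ∀ h : ℝ≥0, 0 < h → h < h₀ →
        (∃ M₀ : ℝ, IsDriftLevel n TL TR K η h M₀) ∧
        ∀ M₀ : ℝ, IsDriftLevel n TL TR K η h M₀ →
          (∀ E : Config n, ∀ᵐ ω ∂(pathLaw (transition TL TR K h) E),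
            returnTime (activeSet n η M₀) ω < ⊤) ∧
          ∃ M₁ : ℝ, 1 < M₁ ∧ ∃ δ : ℝ, 0 < δ ∧
            ∀ E ∈ activeSet n η M₀, M₁ < totalEnergy E →
              ∫⁻ E', ENNReal.ofReal (totalEnergy E')
                ∂(inducedKernel (transition TL TR K h) (measurableSet_activeSet n η M₀) E) ≤
              ENNReal.ofReal ((1 - δ) * totalEnergy E) := by
  -- This threshold ensures `η 2 ^ k < 1/2` for `k ≤ n`, the condition behind `gainExponent_lt`, and
  -- also `η < 1/4`.
  refine ⟨1 / 2 ^ (n + 2), by positivity, 1, one_pos, fun η h0 h1 h hh _ =>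
    ⟨exists_isDriftLevel n TL TR K h0 h1 hh, fun M₀ hM₀ => ?_⟩⟩
  have h4 := eta_lt_quarter h1
  have hα : 0 ≤ 1 - 1 / (2 * (1 - η)) := by
    rw [sub_nonneg, div_le_one (by linarith)]
    linarith
  obtain ⟨c, hc0, hc⟩ := hM₀.exists_add_le hα
  obtain ⟨_, CV, _, hCV⟩ := exists_transition_lowEnergy_drift n TL TR K h0 h1 hh
  have hVm := (measurable_lowEnergy (n := n) η).ennreal_ofReal
  have hWm := (measurable_totalEnergy (n := n)).ennreal_ofReal
  refine ⟨fun E => ae_returnTime_lt_top _ (measurableSet_activeSet n η M₀) hVm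
    (ENNReal.ofReal_pos.2 hc0).ne' hc E (ne_top_of_le_ne_top
      (ENNReal.add_ne_top.2 ⟨ENNReal.ofReal_ne_top, ENNReal.coe_ne_top⟩)
      (le_self_add.trans (hCV E))), ?_⟩
  have hM₀pos : 0 < M₀ := one_pos.trans hM₀.1
  -- `ε = M₀ ^ (-1 / (1 - η))` is the lower bound for all site energies on `G`.
  obtain ⟨δ, CW, hδ, hCW, hdec⟩ := exists_transition_totalEnergy_le n TL TR K hh
    (Real.rpow_pos_of_pos hM₀pos (-(1 / (1 - η))))
  -- The weight for which the drop `b c` of `b V` off `G` equals the possible growth `CW` of `W`.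
  set b : ℝ := CW / c with hb
  have hb0 : 0 ≤ b := div_nonneg CW.coe_nonneg hc0.le
  set D : ℝ := CW + b * (M₀ + CV) with hD
  have hD0 : 0 ≤ D := by positivity
  have hDδ : 0 ≤ D / (δ / 2) := by positivity
  -- Above this level half of the decrease `δ W` absorbs the constant `D`; the summand `2` gives `M₁
  -- > 1`.
  refine ⟨D / (δ / 2) + 2, by linarith, δ / 2, by positivity, fun E hE hEW => ?_⟩
  have hW := totalEnergy_pos E
  have key := lintegral_inducedKernel_le (transition TL TR K h) (measurableSet_activeSet n η M₀)
    (f := fun E => ENNReal.ofReal (totalEnergy E))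
    (F := fun E => ENNReal.ofReal (totalEnergy E) + ENNReal.ofReal b * ENNReal.ofReal (lowEnergy η E))
    hWm (hWm.add (hVm.const_mul _)) (fun _ => le_self_add) ?_ E
  · refine key.trans ?_
    rw [lintegral_add_left hWm, lintegral_const_mul _ hVm]
    have hP1 := hdec E fun l => rpow_le_energy (by linarith) E l hE
    have hP2 : ∫⁻ E', ENNReal.ofReal (lowEnergy η E') ∂(transition TL TR K h E) ≤
        ENNReal.ofReal (M₀ + CV) := by
      refine le_self_add.trans ((hCV E).trans ?_)
      rw [ENNReal.ofReal_add hM₀pos.le CV.coe_nonneg, ENNReal.ofReal_coe_nnreal]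
      gcongr
      exact hE
    have hP3 : ∫⁻ E', ENNReal.ofReal (totalEnergy E') ∂(transition TL TR K h E)
        + ENNReal.ofReal b
          * ∫⁻ E', ENNReal.ofReal (lowEnergy η E') ∂(transition TL TR K h E)
        + ENNReal.ofReal (δ * totalEnergy E) ≤ ENNReal.ofReal (totalEnergy E + D) := by
      rw [add_right_comm, hD, ← add_assoc, ENNReal.ofReal_add (by positivity) (by positivity),
        ENNReal.ofReal_add hW.le CW.coe_nonneg, ENNReal.ofReal_coe_nnreal, ENNReal.ofReal_mul hb0]
      exact add_le_add hP1 (mul_le_mul_right hP2 _)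
    have hDle : D ≤ δ / 2 * totalEnergy E := by
      have : D / (δ / 2) ≤ totalEnergy E := by linarith
      rwa [div_le_iff₀ (by positivity), mul_comm] at this
    have hsub := ENNReal.le_sub_of_add_le_right ENNReal.ofReal_ne_top hP3
    rw [← ENNReal.ofReal_sub _ (by positivity)] at hsub
    refine hsub.trans (ENNReal.ofReal_le_ofReal ?_)
    linarith
  -- Off `G` the function `W + b V` does not increase in mean, because `b c = CW`.
  · intro E' hE'
    rw [lintegral_add_left hWm, lintegral_const_mul _ hVm]
    have hbc : ENNReal.ofReal b * ENNReal.ofReal c = CW := by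
      rw [← ENNReal.ofReal_mul hb0, hb, div_mul_cancel₀ _ hc0.ne', ENNReal.ofReal_coe_nnreal]
    calc _ ≤ (ENNReal.ofReal (totalEnergy E') + CW) + ENNReal.ofReal b
          * ∫⁻ E'', ENNReal.ofReal (lowEnergy η E'') ∂(transition TL TR K h E') := by
          gcongr
          exact hCW E'
      _ = ENNReal.ofReal (totalEnergy E') + ENNReal.ofReal b
          * (∫⁻ E'', ENNReal.ofReal (lowEnergy η E'') ∂(transition TL TR K h E')
            + ENNReal.ofReal c) := by rw [← hbc]; ring
      _ ≤ _ := by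
          gcongr
          exact hc E' hE'
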